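/- **Network.** Let $\mathcal G=(\mathcal I,\mathcal E)$ be a connected undirected graph with buses $\mathcal I=\{1,\dots,n\}$ and lines $\mathcal E=\{e_1,\dots,e_m\}$, with an arbitrary orientation and incidence matrix $D\in\mathbb R^{m\times n}$. Let $M_i\ge 0$ (inertia, at least one $M_i>0$), $E_i>0$ (damping), $p\in\mathbb R^n$ with $\mathbf 1^Tp=0$ (power injection), $Y_b=\operatorname{diag}(b_1,\dots,b_m)$ with $b_j>0$ (susceptances), $M=\operatorname{diag}(M_i)$, $E=\operatorname{diag}(E_i)$. The state $(\lambda,\omega)\in\mathbb R^{m}\times\mathbb R^n$ obeys, for $t\ge 0$, $$\dot\lambda=D\omega,\qquad M\dot\omega=-E\omega-D^TY_b\sin\lambda+p+\alpha,\qquad \lambda(0)\in\operatorname{range}(D),$$ which is an algebraic equation at buses with $M_i=0$. Put $L=D^TY_bD$, $\|z\|_{\mathcal E,\infty}=\max_{(i,j)\in\mathcal E}|z_i-z_j|$ and $\Upsilon=\{\lambda\in\mathbb R^m:|\lambda_j|<\pi/2\ \forall j\}$. Assume $$\|L^\dagger p\|_{\mathcal E,\infty}<1,$$ and let $\lambda_\infty\in\Upsilon\cap\operatorname{range}(D)$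 with $D^TY_b\sin\lambda_\infty=p$ be the phase differences of an equilibrium $(\lambda_\infty,\mathbf 0)$ of the uncontrolled system. **Controller.** Let $\mathcal I_\omega\subseteq\mathcal I_u\subseteq\mathcal I$ and $\alpha=\alpha_{TL}+\alpha_{BL}$. For $i\in\mathcal I_u$ let $\epsilon_i,\tau_i,c_i>0$ with $\epsilon_i\tau_i<1$. For $i\in\mathcal I_\omega$ let $d_i,\bar\gamma_i,\underline\gamma_i>0$ and $\underline\omega_i<\underline\omega_i^{\rm thr}<0<\bar\omega_i^{\rm thr}<\bar\omega_i$. Let $0=t^0<t^1<\cdots$ with $t^w\to\infty$ be sampling times, $T,\tilde t>0$, $N=\lceil\tilde t/T\rceil$. *MPC.* On $[t^w,t^{w+1})$ the signal $u_{MPC}$ is constant, equal to the component $\hat u$ of an optimal solution $(\hat X,\hat u,S)$ of the following problem, where $\hat x=(\hat\lambda,\hat\omega,\hat\alpha_{BL})$, $x=(\lambda,\omega,\alpha_{BL})$, $F,A\in\mathbb R^{(m+2n)\times(m+2n)}$ and $B_1,B_2\in\mathbb R^{(m+2n)\times n}$ are the matrices of the prediction model, and $\hat p^{fcst}(k)\in\mathbb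 R^n$ are the forecasted injections at times $t^w+(k-1)T$: minimize $$\sum_{k=1}^N\Big(\sum_{i\in\mathcal I_u}c_i\hat\alpha_{BL,i}^2(k)+\sum_{i\in\mathcal I_\omega}d_is_i^2(k)\Big)$$ subject to $F\hat x(k+1)=A\hat x(k)+B_1\hat p^{fcst}(k)+B_2\hat u$ for $1\le k<N$; $\hat x(1)=x(t^w)$; $\hat u_i=0$ for $i\notin\mathcal I_u$; $\underline\omega_i-s_i(k)\le\hat\omega_i(k)\le\bar\omega_i+s_i(k)$ for $i\in\mathcal I_\omega$, $1\le k\le N$; and $|\hat u_i|\le\epsilon_i|\alpha_{BL,i}(t^w)|$ for $i\in\mathcal I_u$. *Stability and low-pass filters.* $\hat u_{MPC,i}(t)$ is the saturation of $u_{MPC,i}(t)$ to the interval $[-\epsilon_i|\alpha_{BL,i}(t)|,\epsilon_i|\alpha_{BL,i}(t)|]$. The signal $\alpha_{BL}$ satisfies $\dot\alpha_{BL,i}=-\frac1{\tau_i}\alpha_{BL,i}-\omega_i+\hat u_{MPC,i}$ for $i\in\mathcal I_u$ and $\alpha_{BL,i}\equiv0$ for $i\notin\mathcal I_u$. *Top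 layer.* With $v_i=E_i\omega_i+[D^TY_b\sin\lambda]_i-p_i-\alpha_{BL,i}$, for $i\in\mathcal I_\omega$ $$\alpha_{TL,i}=\begin{cases}\min\{0,\ \frac{\bar\gamma_i(\bar\omega_i-\omega_i)}{\omega_i-\bar\omega_i^{\rm thr}}+v_i\}&\omega_i>\bar\omega_i^{\rm thr},\\ 0&\underline\omega_i^{\rm thr}\le\omega_i\le\bar\omega_i^{\rm thr},\\ \max\{0,\ \frac{\underline\gamma_i(\underline\omega_i-\omega_i)}{\underline\omega_i^{\rm thr}-\omega_i}+v_i\}&\omega_i<\underline\omega_i^{\rm thr},\end{cases}$$ and $\alpha_{TL,i}\equiv0$ for $i\notin\mathcal I_\omega$. **Energy.** Let $$\bar V(\lambda,\omega,\alpha_{BL})=\tfrac12\sum_{i}M_i\omega_i^2+\sum_{j=1}^m b_j\big(\cos\lambda_{\infty,j}-\cos\lambda_j-\lambda_j\sin\lambda_{\infty,j}+\lambda_{\infty,j}\sin\lambda_{\infty,j}\big)+\tfrac12\sum_{i\in\mathcal I_u}\alpha_{BL,i}^2,$$ $c=\min_{\tilde\lambda\in\partial\Upsilon}\bar V(\tilde\lambda,\mathbf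 0,\mathbf 0)$ (read as $0$ if there are no lines), $\mathcal T_\rho=\{x:\lambda\in\Upsilon_{cl},\ \bar V(x)\le\rho c\}$, where $\Upsilon_{cl}$ is the closure of $\Upsilon$, and $\mathcal T=\bigcup_{0<\rho<1}\mathcal T_\rho$. **Theorem.** Under these assumptions, consider any solution on $[0,\infty)$ of the closed-loop system (with $\lambda,\omega,\alpha_{BL}$ continuous and the differential equations holding as right derivatives at every $t\ge0$) such that $x(0)\in\mathcal T$. Then: 1. For $i\in\mathcal I_\omega$, if $\omega_i(0)\in[\underline\omega_i,\bar\omega_i]$, then $\omega_i(t)\in[\underline\omega_i,\bar\omega_i]$ for all $t\ge0$. 2. For $i\in\mathcal I_\omega$, if $\omega_i(0)\notin[\underline\omega_i,\bar\omega_i]$, then there is $t_0>0$ such that $\omega_i(t)\notin[\underline\omega_i,\bar\omega_i]$ for $0\le t<t_0$, $\omega_i(t)\in[\underline\omega_i,\bar\omega_i]$ for all $t\ge t_0$, and on $[0,t_0]$ the function $\omega_i$ is strictly decreasing if $\omega_i(0)>\bar\omega_i$ and strictly increasing if $\omega_i(0)<\underline\omega_i$. 3. If $0<\rho<1$ and $x(0)\in\mathcal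 T_\rho$, then $x(t)\in\mathcal T_\rho$ for all $t\ge0$, and as $t\to\infty$ we have $x(t)\to(\lambda_\infty,\mathbf 0,\mathbf 0)$ and $\alpha(t),\alpha_{TL}(t),\alpha_{BL}(t),\hat u_{MPC}(t),u_{MPC}(t)\to\mathbf 0$. -/

import Mathlib

open Filter Topology Matrix

noncomputable section

namespace BilayeredControl

/-! ### The power network -/

/-- Data of a power network on a connected graph `G`: the vertices are the buses, the edges are the
transmission lines.  `pos e` and `neg e` are the positive and negative ends of the line `e` in an
arbitrary orientation.  Buses may have zero inertia. -/
structure PowerNetwork (V : Type*) [Fintype V] (G : SimpleGraph V) where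
  connected : G.Connected
  pos : G.edgeSet → V
  neg : G.edgeSet → V
  ends : ∀ e : G.edgeSet, s(pos e, neg e) = (e : Sym2 V)
  /-- inertia -/
  M : V → ℝ
  M_nonneg : ∀ i, 0 ≤ M i
  exists_M_pos : ∃ i, 0 < M i
  /-- damping (droop) coefficient -/
  E : V → ℝ
  E_pos : ∀ i, 0 < E i
  /-- line susceptance -/
  b : G.edgeSet → ℝ
  b_pos : ∀ e, 0 < b e
  /-- active power injection -/
  p : V → ℝ
  balanced : ∑ i, p i = 0

section Network

variable {V : Type*} [Fintype V] [DecidableEq V] {G : SimpleGraph V} [DecidableRel G.Adj]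

/-- The incidence matrix `D`. -/
def PowerNetwork.D (P : PowerNetwork V G) : Matrix G.edgeSet V ℝ :=
  Matrix.of fun e i => if i = P.pos e then 1 else if i = P.neg e then -1 else 0

/-- The diagonal matrix `Y_b` of line susceptances. -/
def PowerNetwork.Yb (P : PowerNetwork V G) : Matrix G.edgeSet G.edgeSet ℝ :=
  Matrix.diagonal P.b

/-- `L = Dᵀ Y_b D`. -/
def PowerNetwork.L (P : PowerNetwork V G) : Matrix V V ℝ :=
  P.Dᵀ * P.Yb * P.D

/-- The range of the incidence matrix. -/
def PowerNetwork.rangeD (P : PowerNetwork V G) : Set (G.edgeSet → ℝ) :=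
  Set.range fun θ : V → ℝ => P.D *ᵥ θ

/-- The vector `Dᵀ Y_b sin λ` of the power flowing out of the buses. -/
def PowerNetwork.flow (P : PowerNetwork V G) (lam : G.edgeSet → ℝ) : V → ℝ :=
  P.Dᵀ *ᵥ (P.Yb *ᵥ fun e => Real.sin (lam e))

/-- `X` is the Moore-Penrose pseudoinverse of `A` (the four Penrose equations). -/
def IsMoorePenrose {m n : Type*} [Fintype m] [Fintype n]
    (A : Matrix m n ℝ) (X : Matrix n m ℝ) : Prop :=
  A * X * A = A ∧ X * A * X = X ∧ (A * X)ᵀ = A * X ∧ (X * A)ᵀ = X * A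

/-- `‖z‖_{𝓔,∞} = max_{(i,j) ∈ 𝓔} |z_i - z_j|`. -/
def PowerNetwork.edgeNorm (P : PowerNetwork V G) (z : V → ℝ) : ℝ :=
  ⨆ e : G.edgeSet, |z (P.pos e) - z (P.neg e)|

/-- The condition `‖L† p‖_{𝓔,∞} < 1`. -/
def PowerNetwork.SyncCondition (P : PowerNetwork V G) : Prop :=
  ∃ Ldag : Matrix V V ℝ, IsMoorePenrose P.L Ldag ∧ P.edgeNorm (Ldag *ᵥ P.p) < 1

/-- `Υ = {λ | |λ_e| < π/2 for every line e}`. -/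
def Upsilon (G : SimpleGraph V) : Set (G.edgeSet → ℝ) :=
  {lam | ∀ e, |lam e| < Real.pi / 2}

/-- `(λ^∞, 0)` is an equilibrium of the uncontrolled swing dynamics with `λ^∞ ∈ Υ`; `λ^∞` is a
vector of angle differences, so it lies in the range of `D`. -/
structure PowerNetwork.IsSyncEquilibrium (P : PowerNetwork V G)
    (lamInf : G.edgeSet → ℝ) : Prop where
  mem_rangeD : lamInf ∈ P.rangeD
  mem_Upsilon : lamInf ∈ Upsilon G
  equilibrium : P.flow lamInf = P.p

end Network

/-! ### The controller -/

/-- The saturation function with limits `amax` and `amin`. -/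
def sat (a amax amin : ℝ) : ℝ :=
  if amax ≤ a then amax else if a ≤ amin then amin else a

/-- Index set of the augmented state `x = (λ, ω, α_BL)`. -/
abbrev StateIdx {V : Type*} (G : SimpleGraph V) : Type _ := G.edgeSet ⊕ V ⊕ V

/-- The vector `(λ, ω, α_BL)`. -/
def stack {V : Type*} {G : SimpleGraph V} (lam : G.edgeSet → ℝ) (om al : V → ℝ) :
    StateIdx G → ℝ :=
  Sum.elim lam (Sum.elim om al)

/-- The parameters of the bilayered controller. -/
structure Controller (V : Type*) [Fintype V] (G : SimpleGraph V) where
  /-- controlled buses `𝓘_u` -/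
  Iu : Finset V
  /-- buses `𝓘_ω` with a frequency requirement -/
  Iw : Finset V
  Iw_subset : Iw ⊆ Iu
  /-- safe frequency bounds -/
  wlo : V → ℝ
  whi : V → ℝ
  /-- thresholds of the top layer -/
  thrlo : V → ℝ
  thrhi : V → ℝ
  wlo_lt : ∀ i ∈ Iw, wlo i < thrlo i
  thrlo_neg : ∀ i ∈ Iw, thrlo i < 0
  thrhi_pos : ∀ i ∈ Iw, 0 < thrhi i
  lt_whi : ∀ i ∈ Iw, thrhi i < whi i
  /-- gains of the top layer -/
  gamlo : V → ℝ
  gamhi : V → ℝ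
  gamlo_pos : ∀ i ∈ Iw, 0 < gamlo i
  gamhi_pos : ∀ i ∈ Iw, 0 < gamhi i
  /-- parameter of the sensitivity constraint and of the stability filter -/
  eps : V → ℝ
  eps_pos : ∀ i ∈ Iu, 0 < eps i
  /-- time constant of the low-pass filter -/
  tau : V → ℝ
  tau_pos : ∀ i ∈ Iu, 0 < tau i
  /-- cost coefficients of the MPC problem -/
  c : V → ℝ
  c_pos : ∀ i ∈ Iu, 0 < c i
  d : V → ℝ
  d_pos : ∀ i ∈ Iw, 0 < d i
  /-- step size and prediction horizon -/
  T : ℝ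
  T_pos : 0 < T
  horizon : ℝ
  horizon_pos : 0 < horizon
  /-- matrices of the discretized linear prediction model -/
  F : Matrix (StateIdx G) (StateIdx G) ℝ
  A : Matrix (StateIdx G) (StateIdx G) ℝ
  B1 : Matrix (StateIdx G) V ℝ
  B2 : Matrix (StateIdx G) V ℝ
  /-- sampling times -/
  ts : ℕ → ℝ
  ts_zero : ts 0 = 0
  ts_strictMono : StrictMono ts
  ts_tendsto : Tendsto ts atTop atTop
  /-- `pfcst w s` is the injection at time `s` forecasted at the `w`-th sampling time -/
  pfcst : ℕ → ℝ → V → ℝ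

section Controller

variable {V : Type*} [Fintype V] [DecidableEq V] {G : SimpleGraph V} [DecidableRel G.Adj]

/-- The predicted step length `N = ⌈horizon / T⌉`. -/
def Controller.N (C : Controller V G) : ℕ := ⌈C.horizon / C.T⌉₊

/-- The set `𝔸` of admissible controls: no control at buses outside `𝓘_u`. -/
def Controller.admissible (C : Controller V G) : Set (V → ℝ) :=
  {z | ∀ i, i ∉ C.Iu → z i = 0}

/-- The sampled forecast `p̂^fcst_{t^w}(k) = p^fcst_{t^w}(t^w + (k-1) T)`. -/
def Controller.phat (C : Controller V G) (w k : ℕ) : V → ℝ :=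
  C.pfcst w (C.ts w + ((k : ℝ) - 1) * C.T)

/-- The objective function of the MPC problem.  Predicted states are `x̂(k) = X k` and slack
variables are `s(k) = S k` with `k = 1, …, N`; other values of `X`, `S` play no role. -/
def Controller.cost (C : Controller V G) (X : ℕ → StateIdx G → ℝ) (S : ℕ → V → ℝ) : ℝ :=
  ∑ k ∈ Finset.Icc 1 C.N,
    (∑ i ∈ C.Iu, C.c i * X k (Sum.inr (Sum.inr i)) ^ 2 + ∑ i ∈ C.Iw, C.d i * S k i ^ 2)

/-- The constraints of the MPC problem at the `w`-th sampling time, `x0` being the sampled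
state. -/
structure Controller.IsFeasible (C : Controller V G) (w : ℕ) (x0 : StateIdx G → ℝ)
    (X : ℕ → StateIdx G → ℝ) (u : V → ℝ) (S : ℕ → V → ℝ) : Prop where
  dynamics : ∀ k, 1 ≤ k → k < C.N →
    C.F *ᵥ X (k + 1) = C.A *ᵥ X k + C.B1 *ᵥ C.phat w k + C.B2 *ᵥ u
  mem_admissible : u ∈ C.admissible
  initial : X 1 = x0
  soft : ∀ i ∈ C.Iw, ∀ k ∈ Finset.Icc 1 C.N,
    C.wlo i - S k i ≤ X k (Sum.inr (Sum.inl i)) ∧ X k (Sum.inr (Sum.inl i)) ≤ C.whi i + S k i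
  sensitivity : ∀ i ∈ C.Iu, |u i| ≤ C.eps i * |x0 (Sum.inr (Sum.inr i))|

/-- `(X, u, S)` is an optimal solution of the MPC problem. -/
def Controller.IsOptimal (C : Controller V G) (w : ℕ) (x0 : StateIdx G → ℝ)
    (X : ℕ → StateIdx G → ℝ) (u : V → ℝ) (S : ℕ → V → ℝ) : Prop :=
  C.IsFeasible w x0 X u S ∧
    ∀ X' u' S', C.IsFeasible w x0 X' u' S' → C.cost X S ≤ C.cost X' S'

/-- The stability filter `û_MPC`. -/
def Controller.uHat (C : Controller V G) (al u : V → ℝ) : V → ℝ := fun i =>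
  sat (u i) (C.eps i * |al i|) (-(C.eps i * |al i|))

/-- `v_i = E_i ω_i + [Dᵀ Y_b sin λ]_i - p_i - α_{BL,i}`. -/
def PowerNetwork.v (P : PowerNetwork V G) (lam : G.edgeSet → ℝ) (om al : V → ℝ) : V → ℝ :=
  fun i => P.E i * om i + P.flow lam i - P.p i - al i

/-- The top-layer controller `α_TL`. -/
def Controller.alphaTL (C : Controller V G) (P : PowerNetwork V G)
    (lam : G.edgeSet → ℝ) (om al : V → ℝ) : V → ℝ := fun i =>
  if i ∈ C.Iw then
    if C.thrhi i < om i then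
      min 0 (C.gamhi i * (C.whi i - om i) / (om i - C.thrhi i) + P.v lam om al i)
    else if om i < C.thrlo i then
      max 0 (C.gamlo i * (C.wlo i - om i) / (C.thrlo i - om i) + P.v lam om al i)
    else 0
  else 0

/-- The total control signal `α = α_TL + α_BL`. -/
def Controller.alpha (C : Controller V G) (P : PowerNetwork V G)
    (lam : G.edgeSet → ℝ) (om al : V → ℝ) : V → ℝ :=
  C.alphaTL P lam om al + al

/-! ### The closed-loop system -/

/-- `(λ, ω, α_BL)`, together with the MPC output `u`, is a solution on `[0, ∞)` of the swing
dynamics under the bilayered controller.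

The signal `u` is piecewise constant and jumps at the sampling times, so the equations hold in the
sense of right derivatives, at every time `t ≥ 0`; for continuous trajectories this amounts to
usual derivatives off the sampling times.  The swing equation is written with the derivative of
`M_i ω_i`: at a bus with `M_i = 0` it is the algebraic equation `0 = right-hand side`. -/
structure Controller.IsSolution (C : Controller V G) (P : PowerNetwork V G)
    (lam : ℝ → G.edgeSet → ℝ) (om al u : ℝ → V → ℝ) : Prop where
  continuousOn_lam : ContinuousOn lam (Set.Ici 0)
  continuousOn_om : ContinuousOn om (Set.Ici 0)
  continuousOn_al : ContinuousOn al (Set.Ici 0)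
  initial : lam 0 ∈ P.rangeD
  angle : ∀ t, 0 ≤ t → ∀ e,
    HasDerivWithinAt (fun s => lam s e) ((P.D *ᵥ om t) e) (Set.Ici t) t
  swing : ∀ t, 0 ≤ t → ∀ i,
    HasDerivWithinAt (fun s => P.M i * om s i)
      (-(P.E i * om t i) - P.flow (lam t) i + P.p i + C.alpha P (lam t) (om t) (al t) i)
      (Set.Ici t) t
  lowPass : ∀ t, 0 ≤ t → ∀ i ∈ C.Iu,
    HasDerivWithinAt (fun s => al s i)
      (-(1 / C.tau i) * al t i - om t i + C.uHat (al t) (u t) i) (Set.Ici t) t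
  lowPass_zero : ∀ t, 0 ≤ t → ∀ i, i ∉ C.Iu → al t i = 0
  mpc : ∀ w, ∃ X S,
    C.IsOptimal w (stack (lam (C.ts w)) (om (C.ts w)) (al (C.ts w))) X (u (C.ts w)) S
  mpc_hold : ∀ w, ∀ t ∈ Set.Ico (C.ts w) (C.ts (w + 1)), u t = u (C.ts w)

/-! ### The energy function -/

/-- The augmented energy function. -/
def Controller.energy (C : Controller V G) (P : PowerNetwork V G) (lamInf : G.edgeSet → ℝ)
    (lam : G.edgeSet → ℝ) (om al : V → ℝ) : ℝ :=
  1 / 2 * ∑ i, P.M i * om i ^ 2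
    + ∑ e, P.b e * (Real.cos (lamInf e) - Real.cos (lam e) - lam e * Real.sin (lamInf e)
        + lamInf e * Real.sin (lamInf e))
    + 1 / 2 * ∑ i ∈ C.Iu, al i ^ 2

/-- The minimum of the energy over the boundary of `Υ` (with `ω = 0` and `α_BL = 0`). -/
def Controller.critLevel (C : Controller V G) (P : PowerNetwork V G)
    (lamInf : G.edgeSet → ℝ) : ℝ :=
  sInf ((fun lam => C.energy P lamInf lam 0 0) '' frontier (Upsilon G))

/-- The set `𝓣_ρ`. -/
def Controller.level (C : Controller V G) (P : PowerNetwork V G) (lamInf : G.edgeSet → ℝ)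
    (ρ : ℝ) : Set ((G.edgeSet → ℝ) × (V → ℝ) × (V → ℝ)) :=
  {x | x.1 ∈ closure (Upsilon G) ∧
    C.energy P lamInf x.1 x.2.1 x.2.2 ≤ ρ * C.critLevel P lamInf}

/-- The set `𝓣` of admissible initial states, the union of the `𝓣_ρ` with `0 < ρ < 1`. -/
def Controller.region (C : Controller V G) (P : PowerNetwork V G) (lamInf : G.edgeSet → ℝ) :
    Set ((G.edgeSet → ℝ) × (V → ℝ) × (V → ℝ)) :=
  ⋃ ρ ∈ Set.Ioo (0 : ℝ) 1, C.level P lamInf ρ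

end Controller

end BilayeredControl

end

/-!
The proof is a Lyapunov argument in which Barbalat's lemma replaces LaSalle's principle: the closed
loop is neither autonomous (the MPC output depends on samples) nor an ordinary differential equation
(massless buses satisfy algebraic equations), so limit sets need not be invariant.

Along a solution the energy has right derivative `-dissipation`
(`Controller.IsSolution.hasDerivWithinAt_energy`). The damping term dissipates, the top layer always
opposes `ω` (`Controller.mul_alphaTL_nonpos`), and the stability filter with `ε τ < 1` makes the
low-pass filter dissipative whatever the MPC returns (`Controller.sq_le_filter`). Since `-cos` is
strictly convex on `[-π/2, π/2]`, the critical level is positive when there are lines, and a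
trajectory that starts below it can never reach the boundary of `Υ`
(`Controller.IsSolution.mem_Upsilon`).

On `Υ` the energy bounds `α_BL` and the frequencies of the buses with inertia. At a massless bus the
algebraic equation is a complementarity condition (`Controller.massless_cases`), which bounds `ω`
and makes it a Lipschitz function of `flow - p - α_BL`. Hence the signals whose squares the
dissipation dominates are bounded and Lipschitz, and Barbalat's lemma
(`eventually_lt_of_deriv_right_le`) gives `ω → 0` and `α_BL → 0`. Applied once more, to the swing
equation, it gives `flow λ → p`. As `λ` stays in the compact set `closure Υ ∩ range D`, on which the
flow is injective by strict monotonicity of `sin` (`PowerNetwork.eq_of_flow_eq`), `λ` tends to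
`λ^∞`. The MPC output tends to zero by its sensitivity constraint.

For the frequency bounds, the top layer makes the right-hand side of the swing equation nonpositive
where `ω_i ≥ ω̄_i`, and negative where `ω_i > ω̄_i`; a barrier argument
(`le_of_deriv_right_nonpos_of_le`) gives invariance, and `ω_i → 0` gives a finite entrance time. A
massless bus in `𝓘_ω` is always inside its safe interval.
-/

namespace BilayeredControl

/-! ### Real functions on the half-line with right derivatives -/

/-- `f` is bounded on `[0, ∞)`. -/
def HalfLineBounded (f : ℝ → ℝ) : Prop :=
  ∃ K, ∀ t, 0 ≤ t → |f t| ≤ K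

/-- `f` is Lipschitz on `[0, ∞)`. -/
def HalfLineLipschitz (f : ℝ → ℝ) : Prop :=
  ∃ K, ∀ s, 0 ≤ s → ∀ t, 0 ≤ t → |f s - f t| ≤ K * |s - t|

namespace HalfLineBounded

variable {f g : ℝ → ℝ}

theorem mono (hg : HalfLineBounded g) (h : ∀ t, 0 ≤ t → |f t| ≤ |g t|) : HalfLineBounded f := by
  obtain ⟨K, hK⟩ := hg
  exact ⟨K, fun t ht => (h t ht).trans (hK t ht)⟩

theorem const (c : ℝ) : HalfLineBounded fun _ => c := ⟨|c|, fun _ _ => le_rfl⟩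

theorem add (hf : HalfLineBounded f) (hg : HalfLineBounded g) :
    HalfLineBounded fun t => f t + g t := by
  obtain ⟨K, hK⟩ := hf
  obtain ⟨K', hK'⟩ := hg
  exact ⟨K + K', fun t ht => (abs_add_le _ _).trans (add_le_add (hK t ht) (hK' t ht))⟩

theorem const_mul (c : ℝ) (hf : HalfLineBounded f) : HalfLineBounded fun t => c * f t := by
  obtain ⟨K, hK⟩ := hf
  refine ⟨|c| * K, fun t ht => ?_⟩
  rw [abs_mul]
  exact mul_le_mul_of_nonneg_left (hK t ht) (abs_nonneg c)

theorem sub (hf : HalfLineBounded f) (hg : HalfLineBounded g) :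
    HalfLineBounded fun t => f t - g t := by
  simpa [sub_eq_add_neg] using hf.add (hg.const_mul (-1))

theorem abs (hf : HalfLineBounded f) : HalfLineBounded fun t => |f t| :=
  hf.mono fun t _ => (abs_abs (f t)).le

theorem sum {ι : Type*} (s : Finset ι) {F : ι → ℝ → ℝ} (h : ∀ i ∈ s, HalfLineBounded (F i)) :
    HalfLineBounded fun t => ∑ i ∈ s, F i t := by
  choose! K hK using h
  exact ⟨∑ i ∈ s, K i, fun t ht => (Finset.abs_sum_le_sum_abs _ _).trans
    (Finset.sum_le_sum fun i hi => hK i hi t ht)⟩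

theorem of_sq (hf : HalfLineBounded fun t => f t ^ 2) : HalfLineBounded f := by
  obtain ⟨K, hK⟩ := hf
  refine ⟨K + 1, fun t ht => ?_⟩
  have h : |f t| ^ 2 ≤ K := by simpa using hK t ht
  nlinarith [sq_nonneg (|f t| - 1)]

end HalfLineBounded

namespace HalfLineLipschitz

variable {f g : ℝ → ℝ}

theorem const (c : ℝ) : HalfLineLipschitz fun _ => c := ⟨0, fun s _ t _ => by simp⟩

theorem add (hf : HalfLineLipschitz f) (hg : HalfLineLipschitz g) :
    HalfLineLipschitz fun t => f t + g t := by
  obtain ⟨K, hK⟩ := hf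
  obtain ⟨K', hK'⟩ := hg
  refine ⟨K + K', fun s hs t ht => ?_⟩
  rw [add_sub_add_comm, add_mul]
  exact (abs_add_le _ _).trans (add_le_add (hK s hs t ht) (hK' s hs t ht))

theorem const_mul (c : ℝ) (hf : HalfLineLipschitz f) : HalfLineLipschitz fun t => c * f t := by
  obtain ⟨K, hK⟩ := hf
  refine ⟨|c| * K, fun s hs t ht => ?_⟩
  rw [← mul_sub, abs_mul, mul_assoc]
  exact mul_le_mul_of_nonneg_left (hK s hs t ht) (abs_nonneg c)

theorem sub (hf : HalfLineLipschitz f) (hg : HalfLineLipschitz g) :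
    HalfLineLipschitz fun t => f t - g t := by
  simpa [sub_eq_add_neg] using hf.add (hg.const_mul (-1))

theorem sum {ι : Type*} (s : Finset ι) {F : ι → ℝ → ℝ} (h : ∀ i ∈ s, HalfLineLipschitz (F i)) :
    HalfLineLipschitz fun t => ∑ i ∈ s, F i t := by
  choose! K hK using h
  refine ⟨∑ i ∈ s, K i, fun r hr t ht => ?_⟩
  rw [← Finset.sum_sub_distrib, Finset.sum_mul]
  exact (Finset.abs_sum_le_sum_abs _ _).trans (Finset.sum_le_sum fun i hi => hK i hi r hr t ht)

theorem mono (hg : HalfLineLipschitz g)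
    (h : ∀ s, 0 ≤ s → ∀ t, 0 ≤ t → |f s - f t| ≤ |g s - g t|) : HalfLineLipschitz f := by
  obtain ⟨K, hK⟩ := hg
  exact ⟨K, fun s hs t ht => (h s hs t ht).trans (hK s hs t ht)⟩

theorem sin (hf : HalfLineLipschitz f) : HalfLineLipschitz fun t => Real.sin (f t) :=
  hf.mono fun s _ t _ => Real.abs_sin_sub_sin_le (f s) (f t)

theorem sq (hf : HalfLineLipschitz f) (hb : HalfLineBounded f) :
    HalfLineLipschitz fun t => f t ^ 2 := by
  obtain ⟨K, hK⟩ := hf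
  obtain ⟨R, hR⟩ := hb
  refine ⟨2 * R * K, fun s hs t ht => ?_⟩
  have h1 : |f s + f t| ≤ 2 * R := (abs_add_le _ _).trans (by linarith [hR s hs, hR t ht])
  rw [sq_sub_sq, abs_mul, mul_assoc]
  exact mul_le_mul h1 (hK s hs t ht) (abs_nonneg _) ((abs_nonneg _).trans h1)

theorem of_deriv_bounded {f' : ℝ → ℝ} (hf : ContinuousOn f (Set.Ici 0))
    (hf' : ∀ t, 0 ≤ t → HasDerivWithinAt f (f' t) (Set.Ici t) t) (hb : HalfLineBounded f') :
    HalfLineLipschitz f := by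
  obtain ⟨K, hK⟩ := hb
  have key : ∀ s, 0 ≤ s → ∀ t, s ≤ t → |f t - f s| ≤ K * |t - s| := fun s hs t hst => by
    rw [abs_of_nonneg (sub_nonneg.2 hst)]
    exact norm_image_sub_le_of_norm_deriv_right_le_segment (b := t)
      (hf.mono fun x hx => hs.trans hx.1) (fun x hx => hf' x (hs.trans hx.1))
      (fun x hx => hK x (hs.trans hx.1)) t ⟨hst, le_rfl⟩
  refine ⟨K, fun s hs t ht => ?_⟩
  rcases le_total s t with h | h
  · rw [abs_sub_comm, abs_sub_comm s]
    exact key s hs t h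
  · exact key t ht s h

end HalfLineLipschitz

section RightDerivative

variable {g g' : ℝ → ℝ}

theorem sub_le_mul_of_deriv_right_le {a b c : ℝ} (hg : ContinuousOn g (Set.Ici 0))
    (hg' : ∀ t, 0 ≤ t → HasDerivWithinAt g (g' t) (Set.Ici t) t) (ha : 0 ≤ a) (hab : a ≤ b)
    (h : ∀ t ∈ Set.Ico a b, g' t ≤ c) : g b - g a ≤ c * (b - a) := by
  have := image_le_of_deriv_right_le_deriv_boundary (f := g) (f' := g') (a := a) (b := b)
    (B := fun t => g a + c * (t - a)) (B' := fun _ => c)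
    (hg.mono fun x hx => ha.trans hx.1) (fun x hx => hg' x (ha.trans hx.1)) (by simp)
    (by fun_prop)
    (fun x _ => by simpa using
      ((((hasDerivAt_id x).sub_const a).const_mul c).const_add (g a)).hasDerivWithinAt)
    h ⟨hab, le_rfl⟩
  linarith

/-- A sublevel set `{g ≤ B}` cannot be left if `g` does not increase wherever `g ≥ B`. -/
theorem le_of_deriv_right_nonpos_of_le {B a : ℝ} (hg : ContinuousOn g (Set.Ici 0))
    (hg' : ∀ t, 0 ≤ t → HasDerivWithinAt g (g' t) (Set.Ici t) t)
    (hB : ∀ t, 0 ≤ t → B ≤ g t → g' t ≤ 0) (ha : 0 ≤ a) (h0 : g a ≤ B) :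
    ∀ t, a ≤ t → g t ≤ B := by
  intro t hat
  -- compare with the barriers `B + δ (s - a)`, which have positive slope, and let `δ → 0`
  have key : ∀ δ : ℝ, 0 < δ → g t ≤ B + δ * (t - a) := fun δ hδ =>
    image_le_of_deriv_right_lt_deriv_boundary' (f := g) (f' := g') (a := a) (b := t)
      (B := fun s => B + δ * (s - a)) (B' := fun _ => δ)
      (hg.mono fun x hx => ha.trans hx.1) (fun x hx => hg' x (ha.trans hx.1)) (by simpa using h0)
      (by fun_prop)
      (fun x _ => by simpa using
        ((((hasDerivAt_id x).sub_const a).const_mul δ).const_add B).hasDerivWithinAt)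
      (fun x hx hxB => (hB x (ha.trans hx.1) (by
        rw [hxB]
        have := mul_nonneg hδ.le (sub_nonneg.2 hx.1)
        linarith)).trans_lt hδ) ⟨hat, le_rfl⟩
  have hlim : Tendsto (fun δ : ℝ => B + δ * (t - a)) (𝓝[>] 0) (𝓝 (B + 0 * (t - a))) :=
    tendsto_nhdsWithin_of_tendsto_nhds (Continuous.tendsto (by fun_prop) 0)
  rw [zero_mul, add_zero] at hlim
  exact ge_of_tendsto hlim (eventually_nhdsWithin_of_forall key)

theorem strictAntiOn_of_deriv_right_neg {b : ℝ} (hg : ContinuousOn g (Set.Ici 0))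
    (hg' : ∀ t, 0 ≤ t → HasDerivWithinAt g (g' t) (Set.Ici t) t)
    (h : ∀ t ∈ Set.Ico 0 b, g' t < 0) : StrictAntiOn g (Set.Icc 0 b) := by
  have hanti : ∀ s ∈ Set.Icc 0 b, ∀ t ∈ Set.Icc 0 b, s ≤ t → g t ≤ g s := fun s hs t ht hst => by
    simpa using sub_le_mul_of_deriv_right_le (c := 0) hg hg' hs.1 hst
      fun x hx => (h x ⟨hs.1.trans hx.1, hx.2.trans_le ht.2⟩).le
  intro s hs t ht hst
  refine lt_of_le_of_ne (hanti s hs t ht hst.le) fun heq => ?_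
  -- otherwise `g` is constant on `[s, t]`, so its right derivative at `s` vanishes
  have hconst : ∀ x ∈ Set.Icc s t, g x = g s := fun x hx =>
    le_antisymm (hanti s hs x ⟨hs.1.trans hx.1, hx.2.trans ht.2⟩ hx.1)
      (heq ▸ hanti x ⟨hs.1.trans hx.1, hx.2.trans ht.2⟩ t ht hx.2)
  have h0 : HasDerivWithinAt g 0 (Set.Ici s) s := by
    refine (hasDerivWithinAt_const s (Set.Ici s) (g s)).congr_of_eventuallyEq ?_ rfl
    filter_upwards [Icc_mem_nhdsGE hst] with x hx using hconst x hx
  have := (uniqueDiffOn_Ici s s Set.self_mem_Ici).eq_deriv _ (hg' s hs.1) h0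
  exact (h s ⟨hs.1, hst.trans_le ht.2⟩).ne this

/-- A form of Barbalat's lemma for right derivatives. -/
theorem eventually_lt_of_deriv_right_le {f r : ℝ → ℝ} {l ε : ℝ} (hg : ContinuousOn g (Set.Ici 0))
    (hg' : ∀ t, 0 ≤ t → HasDerivWithinAt g (g' t) (Set.Ici t) t)
    (hle : ∀ᶠ t in atTop, g' t ≤ -f t + r t) (hf : HalfLineLipschitz f)
    (hr : Tendsto r atTop (𝓝 0)) (hlim : Tendsto g atTop (𝓝 l)) (hε : 0 < ε) :
    ∀ᶠ t in atTop, f t < ε := by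
  obtain ⟨K, hK⟩ := hf
  -- on `[t, t + h]` the function `f` varies by at most `ε / 4`
  set h : ℝ := ε / (4 * (|K| + 1)) with hh
  have hK1 : 0 < |K| + 1 := by positivity
  have hpos : 0 < h := by positivity
  have hKh : (|K| + 1) * h = ε / 4 := by rw [hh]; field_simp
  have hη : 0 < h * ε / 8 := by positivity
  obtain ⟨T, hT⟩ := eventually_atTop.1
    ((hle.and (hr.eventually_lt_const (show 0 < ε / 4 by positivity))).and
      ((hlim.eventually_lt_const (show l < l + h * ε / 8 by linarith)).and
        (hlim.eventually_const_lt (show l - h * ε / 8 < l by linarith))))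
  filter_upwards [eventually_ge_atTop (max T 0)] with t ht
  by_contra! hft
  have hTt : T ≤ t := (le_max_left _ _).trans ht
  have ht0 : 0 ≤ t := (le_max_right _ _).trans ht
  have := sub_le_mul_of_deriv_right_le (a := t) (b := t + h) (c := -(ε / 2)) hg hg' ht0
    (by linarith) fun s hs => by
      obtain ⟨⟨h1, h2⟩, -⟩ := hT s (hTt.trans hs.1)
      have h3 := hK t ht0 s (ht0.trans hs.1)
      have h4 : K * |t - s| ≤ (|K| + 1) * h := by
        rw [abs_sub_comm, abs_of_nonneg (sub_nonneg.2 hs.1)]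
        exact mul_le_mul ((le_abs_self K).trans (by linarith)) (by linarith [hs.2])
          (sub_nonneg.2 hs.1) hK1.le
      have h5 := (le_abs_self _).trans (h3.trans h4)
      linarith
  have h1 := (hT t hTt).2.1
  have h2 := (hT (t + h) (by linarith)).2.2
  rw [add_sub_cancel_left] at this
  nlinarith [mul_pos hpos hε]

theorem exists_entrance_time {g : ℝ → ℝ} {B : ℝ} (hg : ContinuousOn g (Set.Ici 0))
    (h0 : B < g 0) (hB : ∀ᶠ t in atTop, g t < B) :
    ∃ t₀, 0 < t₀ ∧ (∀ t ∈ Set.Ico 0 t₀, B < g t) ∧ g t₀ ≤ B := by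
  set S : Set ℝ := Set.Ici 0 ∩ g ⁻¹' Set.Iic B
  have hS : IsClosed S := hg.preimage_isClosed_of_isClosed isClosed_Ici isClosed_Iic
  have hne : S.Nonempty := by
    obtain ⟨t, h1, h2⟩ := (hB.and (eventually_ge_atTop 0)).exists
    exact ⟨t, h2, h1.le⟩
  have hbdd : BddBelow S := ⟨0, fun t ht => ht.1⟩
  have hmem : sInf S ∈ S := hS.csInf_mem hne hbdd
  refine ⟨sInf S, lt_of_le_of_ne hmem.1 fun heq => ?_, fun t ht => ?_, hmem.2⟩
  · have := hmem.2
    rw [← heq] at this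
    exact absurd h0 (not_lt.2 this)
  · by_contra! hle
    exact absurd (csInf_le hbdd ⟨ht.1, hle⟩) (not_le.2 ht.2)

end RightDerivative

/-! ### Power flow and potential energy of the network -/

section Scalar

open Real

theorem sub_mul_sin_sub_sin_pos {a x : ℝ} (ha : |a| ≤ π / 2) (hx : |x| ≤ π / 2) (hne : x ≠ a) :
    0 < (x - a) * (sin x - sin a) := by
  rw [abs_le] at ha hx
  rcases lt_or_gt_of_ne hne with h | h
  · exact mul_pos_of_neg_of_neg (sub_neg.2 h) (sub_neg.2 (strictMonoOn_sin hx ha h))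
  · exact mul_pos (sub_pos.2 h) (sub_pos.2 (strictMonoOn_sin ha hx h))

/-- The Bregman divergence of `-cos` is positive on `[-π/2, π/2]`, where `-cos` is strictly
convex. -/
theorem cos_bregman_pos {a x : ℝ} (ha : |a| ≤ π / 2) (hx : |x| ≤ π / 2) (hne : x ≠ a) :
    0 < cos a - cos x - x * sin a + a * sin a := by
  have ha' := abs_le.1 ha
  have hx' := abs_le.1 hx
  -- by the mean value theorem the divergence is `(x - a) (sin ξ - sin a)`, `ξ` between `a` and `x`
  rcases lt_or_gt_of_ne hne with h | h
  · obtain ⟨ξ, hξ, he⟩ := exists_hasDerivAt_eq_slope cos (fun y => -sin y) h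
      continuous_cos.continuousOn fun y _ => hasDerivAt_cos y
    rw [eq_div_iff (sub_pos.2 h).ne'] at he
    have hs : sin ξ < sin a :=
      strictMonoOn_sin ⟨by linarith [hξ.1], by linarith [hξ.2]⟩ ha' hξ.2
    nlinarith [mul_pos (sub_pos.2 h) (sub_pos.2 hs)]
  · obtain ⟨ξ, hξ, he⟩ := exists_hasDerivAt_eq_slope cos (fun y => -sin y) h
      continuous_cos.continuousOn fun y _ => hasDerivAt_cos y
    rw [eq_div_iff (sub_pos.2 h).ne'] at he
    have hs : sin a < sin ξ :=
      strictMonoOn_sin ha' ⟨by linarith [hξ.1], by linarith [hξ.2]⟩ hξ.1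
    nlinarith [mul_pos (sub_pos.2 h) (sub_pos.2 hs)]

theorem cos_bregman_nonneg {a x : ℝ} (ha : |a| ≤ π / 2) (hx : |x| ≤ π / 2) :
    0 ≤ cos a - cos x - x * sin a + a * sin a := by
  rcases eq_or_ne x a with rfl | hne
  · simp
  · exact (cos_bregman_pos ha hx hne).le

end Scalar

section Network

variable {V : Type*} [Fintype V] [DecidableEq V] {G : SimpleGraph V} [DecidableRel G.Adj]

omit [Fintype V] [DecidableEq V] [DecidableRel G.Adj] in
theorem closure_Upsilon_subset {x : G.edgeSet → ℝ} (hx : x ∈ closure (Upsilon G))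
    (e : G.edgeSet) : |x e| ≤ Real.pi / 2 :=
  closure_minimal (t := {y : G.edgeSet → ℝ | |y e| ≤ Real.pi / 2}) (fun _ hy => (hy e).le)
    (isClosed_le (by fun_prop) continuous_const) hx

omit [DecidableEq V] [DecidableRel G.Adj] in
theorem isOpen_Upsilon : IsOpen (Upsilon G) := by
  simp only [Upsilon, Set.ofPred_forall]
  exact isOpen_iInter_of_finite fun e => isOpen_lt (by fun_prop) continuous_const

omit [Fintype V] [DecidableEq V] [DecidableRel G.Adj] in
theorem isCompact_closure_Upsilon : IsCompact (closure (Upsilon G)) :=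
  (isCompact_univ_pi fun _ => isCompact_Icc (a := -(Real.pi / 2))
    (b := Real.pi / 2)).of_isClosed_subset isClosed_closure fun _ hx e _ => abs_le.1 (closure_Upsilon_subset hx e)

namespace PowerNetwork

variable (P : PowerNetwork V G)

theorem flow_apply (x : G.edgeSet → ℝ) (i : V) :
    P.flow x i = ∑ e, P.D e i * (P.b e * Real.sin (x e)) := by
  simp [flow, Yb, Matrix.mulVec, dotProduct, Matrix.diagonal_apply]

theorem continuous_flow : Continuous P.flow := by
  refine continuous_pi fun i => ?_
  simp only [flow_apply]
  fun_prop

/-- The power drawn by the flow equals the power exchanged along the lines. -/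
theorem sum_mul_flow (x : G.edgeSet → ℝ) (w : V → ℝ) :
    ∑ i, w i * P.flow x i = ∑ e, P.b e * Real.sin (x e) * (P.D *ᵥ w) e := by
  simp only [flow_apply, Matrix.mulVec, dotProduct, Finset.mul_sum]
  rw [Finset.sum_comm]
  exact Finset.sum_congr rfl fun e _ => Finset.sum_congr rfl fun i _ => by ring

omit [DecidableRel G.Adj] in
theorem rangeD_eq_range_mulVecLin :
    P.rangeD = (LinearMap.range P.D.mulVecLin : Set (G.edgeSet → ℝ)) := by
  ext x
  simp [rangeD]

omit [DecidableRel G.Adj] in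
theorem isClosed_rangeD : IsClosed P.rangeD := by
  rw [rangeD_eq_range_mulVecLin]
  exact Submodule.closed_of_finiteDimensional _

/-- Strict monotonicity of `sin` on `[-π/2, π/2]` makes the angle differences with a given flow
unique. -/
theorem eq_of_flow_eq {x y : G.edgeSet → ℝ} (hx : x ∈ P.rangeD) (hy : y ∈ P.rangeD)
    (hxb : ∀ e, |x e| ≤ Real.pi / 2) (hyb : ∀ e, |y e| ≤ Real.pi / 2)
    (h : P.flow x = P.flow y) : x = y := by
  obtain ⟨θ, rfl⟩ := hx
  obtain ⟨η, rfl⟩ := hy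
  set x := P.D *ᵥ θ
  set y := P.D *ᵥ η
  have hsum : ∑ e, P.b e * ((x e - y e) * (Real.sin (x e) - Real.sin (y e))) = 0 := by
    have h1 := P.sum_mul_flow x (θ - η)
    have h2 := P.sum_mul_flow y (θ - η)
    rw [h] at h1
    rw [← sub_eq_zero.2 (h1.symm.trans h2), ← Finset.sum_sub_distrib]
    refine Finset.sum_congr rfl fun e _ => ?_
    rw [Matrix.mulVec_sub, Pi.sub_apply]
    ring
  have hnonneg : ∀ e ∈ Finset.univ,
      0 ≤ P.b e * ((x e - y e) * (Real.sin (x e) - Real.sin (y e))) := fun e _ => by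
    rcases eq_or_ne (x e) (y e) with he | he
    · simp [he]
    · exact (mul_pos (P.b_pos e) (sub_mul_sin_sub_sin_pos (hyb e) (hxb e) he)).le
  funext e
  by_contra he
  exact (mul_pos (P.b_pos e) (sub_mul_sin_sub_sin_pos (hyb e) (hxb e) he)).ne'
    ((Finset.sum_eq_zero_iff_of_nonneg hnonneg).1 hsum e (Finset.mem_univ e))

omit [DecidableEq V] in
theorem potential_nonneg {lamInf : G.edgeSet → ℝ} (hInf : lamInf ∈ Upsilon G) {x : G.edgeSet → ℝ}
    (hx : x ∈ closure (Upsilon G)) :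
    0 ≤ ∑ e, P.b e * (Real.cos (lamInf e) - Real.cos (x e) - x e * Real.sin (lamInf e)
      + lamInf e * Real.sin (lamInf e)) :=
  Finset.sum_nonneg fun e _ => mul_nonneg (P.b_pos e).le
    (cos_bregman_nonneg (hInf e).le (closure_Upsilon_subset hx e))

end PowerNetwork

namespace Controller

variable (C : Controller V G) (P : PowerNetwork V G) {lamInf : G.edgeSet → ℝ}

omit [DecidableEq V] in
theorem energy_zero_zero_le (x : G.edgeSet → ℝ) (w a : V → ℝ) :
    C.energy P lamInf x 0 0 ≤ C.energy P lamInf x w a := by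
  have h1 : 0 ≤ ∑ i, P.M i * w i ^ 2 :=
    Finset.sum_nonneg fun i _ => mul_nonneg (P.M_nonneg i) (sq_nonneg _)
  have h2 : 0 ≤ ∑ i ∈ C.Iu, a i ^ 2 := Finset.sum_nonneg fun i _ => sq_nonneg _
  simp only [energy, Pi.zero_apply]
  norm_num
  linarith

omit [DecidableEq V] in
theorem energy_frontier_pos (hInf : lamInf ∈ Upsilon G) {x : G.edgeSet → ℝ}
    (hx : x ∈ frontier (Upsilon G)) : 0 < C.energy P lamInf x 0 0 := by
  have hxc : x ∈ closure (Upsilon G) := frontier_subset_closure hx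
  have hne : x ≠ lamInf := by
    rintro rfl
    rw [isOpen_Upsilon.frontier_eq] at hx
    exact hx.2 hInf
  obtain ⟨e, he⟩ := Function.ne_iff.1 hne
  simp only [energy, Pi.zero_apply]
  norm_num
  exact Finset.sum_pos' (fun e _ => mul_nonneg (P.b_pos e).le
    (cos_bregman_nonneg (hInf e).le (closure_Upsilon_subset hxc e)))
    ⟨e, Finset.mem_univ e, mul_pos (P.b_pos e)
      (cos_bregman_pos (hInf e).le (closure_Upsilon_subset hxc e) he)⟩

omit [DecidableEq V] in
/-- On the boundary of `Υ` the energy exceeds every level `ρ c` with `ρ < 1`. -/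
theorem lt_energy_of_mem_frontier (hInf : lamInf ∈ Upsilon G) {x : G.edgeSet → ℝ}
    (hx : x ∈ frontier (Upsilon G)) (w a : V → ℝ) {ρ : ℝ} (hρ : ρ < 1) :
    ρ * C.critLevel P lamInf < C.energy P lamInf x w a := by
  have hK : IsCompact (frontier (Upsilon G)) :=
    isCompact_closure_Upsilon.of_isClosed_subset isClosed_frontier frontier_subset_closure
  have hcont : Continuous fun y => C.energy P lamInf y 0 0 := by
    unfold energy
    fun_prop
  have himg := hK.image hcont
  obtain ⟨y, hy, hyc⟩ := himg.sInf_mem (Set.Nonempty.image _ ⟨x, hx⟩)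
  have hcpos : 0 < C.critLevel P lamInf := by
    rw [critLevel, ← hyc]
    exact C.energy_frontier_pos P hInf hy
  have hle : C.critLevel P lamInf ≤ C.energy P lamInf x 0 0 :=
    csInf_le himg.bddBelow ⟨x, hx, rfl⟩
  nlinarith [C.energy_zero_zero_le P (lamInf := lamInf) x w a]

end Controller

end Network

/-! ### Pointwise properties of the controller -/

theorem abs_sat_le {a r : ℝ} (hr : 0 ≤ r) : |sat a r (-r)| ≤ r := by
  unfold sat
  split_ifs with h1 h2
  · exact (abs_of_nonneg hr).le
  · rw [abs_neg, abs_of_nonneg hr]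
  · exact abs_le.2 ⟨(not_le.1 h2).le, (not_le.1 h1).le⟩

section Controller

variable {V : Type*} [Fintype V] [DecidableEq V] {G : SimpleGraph V} [DecidableRel G.Adj]

namespace Controller

variable (C : Controller V G) (P : PowerNetwork V G) {x : G.edgeSet → ℝ} {w a : V → ℝ} {i : V}

omit [DecidableEq V] [DecidableRel G.Adj] in
theorem abs_uHat_le (hi : i ∈ C.Iu) (a u : V → ℝ) : |C.uHat a u i| ≤ C.eps i * |a i| :=
  abs_sat_le (mul_nonneg (C.eps_pos i hi).le (abs_nonneg _))

omit [DecidableEq V] [DecidableRel G.Adj] in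
theorem uHat_eq_zero {u : V → ℝ} (ha : a i = 0) (hu : u i = 0) : C.uHat a u i = 0 := by
  simp [uHat, sat, ha, hu]

omit [DecidableEq V] [DecidableRel G.Adj] in
theorem wlo_neg (hi : i ∈ C.Iw) : C.wlo i < 0 := (C.wlo_lt i hi).trans (C.thrlo_neg i hi)

omit [DecidableEq V] [DecidableRel G.Adj] in
theorem whi_pos (hi : i ∈ C.Iw) : 0 < C.whi i := (C.thrhi_pos i hi).trans (C.lt_whi i hi)

theorem alphaTL_of_notMem (hi : i ∉ C.Iw) : C.alphaTL P x w a i = 0 := if_neg hi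

theorem alphaTL_of_mem_Icc (hw : w i ∈ Set.Icc (C.thrlo i) (C.thrhi i)) :
    C.alphaTL P x w a i = 0 := by
  simp [alphaTL, not_lt.2 hw.1, not_lt.2 hw.2]

theorem alphaTL_of_thrhi_lt (hi : i ∈ C.Iw) (hw : C.thrhi i < w i) :
    C.alphaTL P x w a i =
      min 0 (C.gamhi i * (C.whi i - w i) / (w i - C.thrhi i) + P.v x w a i) := by
  simp [alphaTL, hi, hw]

theorem alphaTL_of_lt_thrlo (hi : i ∈ C.Iw) (hw : w i < C.thrlo i) :
    C.alphaTL P x w a i =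
      max 0 (C.gamlo i * (C.wlo i - w i) / (C.thrlo i - w i) + P.v x w a i) := by
  have h : ¬ C.thrhi i < w i := by linarith [C.thrlo_neg i hi, C.thrhi_pos i hi]
  simp [alphaTL, hi, hw, h]

/-- The top layer never injects energy. -/
theorem mul_alphaTL_nonpos : w i * C.alphaTL P x w a i ≤ 0 := by
  by_cases hi : i ∈ C.Iw
  · rcases lt_or_ge (C.thrhi i) (w i) with h | h
    · rw [C.alphaTL_of_thrhi_lt P hi h]
      exact mul_nonpos_of_nonneg_of_nonpos ((C.thrhi_pos i hi).trans h).le (min_le_left _ _)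
    · rcases lt_or_ge (w i) (C.thrlo i) with h' | h'
      · rw [C.alphaTL_of_lt_thrlo P hi h']
        exact mul_nonpos_of_nonpos_of_nonneg (h'.trans (C.thrlo_neg i hi)).le (le_max_left _ _)
      · rw [C.alphaTL_of_mem_Icc P ⟨h', h⟩, mul_zero]
  · rw [C.alphaTL_of_notMem P hi, mul_zero]

/-- The difference `α_TL - v` is the right-hand side of the swing equation; the `min` in the top
layer bounds it by a quotient that is nonpositive beyond the upper frequency bound. -/
theorem alphaTL_sub_v_nonpos (hi : i ∈ C.Iw) (hw : C.whi i ≤ w i) :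
    C.alphaTL P x w a i - P.v x w a i ≤ 0 := by
  have hthr := (C.lt_whi i hi).trans_le hw
  have h : C.gamhi i * (C.whi i - w i) / (w i - C.thrhi i) ≤ 0 :=
    div_nonpos_of_nonpos_of_nonneg
      (mul_nonpos_of_nonneg_of_nonpos (C.gamhi_pos i hi).le (by linarith)) (by linarith)
  rw [C.alphaTL_of_thrhi_lt P hi hthr]
  linarith [min_le_right 0 (C.gamhi i * (C.whi i - w i) / (w i - C.thrhi i) + P.v x w a i)]

theorem alphaTL_sub_v_neg (hi : i ∈ C.Iw) (hw : C.whi i < w i) :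
    C.alphaTL P x w a i - P.v x w a i < 0 := by
  have hthr := (C.lt_whi i hi).trans hw
  have h : C.gamhi i * (C.whi i - w i) / (w i - C.thrhi i) < 0 :=
    div_neg_of_neg_of_pos (mul_neg_of_pos_of_neg (C.gamhi_pos i hi) (by linarith)) (by linarith)
  rw [C.alphaTL_of_thrhi_lt P hi hthr]
  linarith [min_le_right 0 (C.gamhi i * (C.whi i - w i) / (w i - C.thrhi i) + P.v x w a i)]

theorem alphaTL_sub_v_nonneg (hi : i ∈ C.Iw) (hw : w i ≤ C.wlo i) :
    0 ≤ C.alphaTL P x w a i - P.v x w a i := by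
  have hthr := hw.trans_lt (C.wlo_lt i hi)
  have h : 0 ≤ C.gamlo i * (C.wlo i - w i) / (C.thrlo i - w i) :=
    div_nonneg (mul_nonneg (C.gamlo_pos i hi).le (by linarith)) (by linarith)
  rw [C.alphaTL_of_lt_thrlo P hi hthr]
  linarith [le_max_right 0 (C.gamlo i * (C.wlo i - w i) / (C.thrlo i - w i) + P.v x w a i)]

theorem alphaTL_sub_v_pos (hi : i ∈ C.Iw) (hw : w i < C.wlo i) :
    0 < C.alphaTL P x w a i - P.v x w a i := by
  have hthr := hw.trans (C.wlo_lt i hi)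
  have h : 0 < C.gamlo i * (C.wlo i - w i) / (C.thrlo i - w i) :=
    div_pos (mul_pos (C.gamlo_pos i hi) (by linarith)) (by linarith)
  rw [C.alphaTL_of_lt_thrlo P hi hthr]
  linarith [le_max_right 0 (C.gamlo i * (C.wlo i - w i) / (C.thrlo i - w i) + P.v x w a i)]

/-- Although its quotient terms are singular at the thresholds, the top layer is bounded in terms
of `v`: the singularities are cut off by the `min` and the `max`. -/
theorem abs_alphaTL_le : |C.alphaTL P x w a i| ≤ |C.gamhi i| + |C.gamlo i| + |P.v x w a i| := by
  have h0 := abs_nonneg (C.gamhi i)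
  have h1 := abs_nonneg (C.gamlo i)
  have h2 := abs_nonneg (P.v x w a i)
  have h3 := neg_abs_le (P.v x w a i)
  have h4 := le_abs_self (P.v x w a i)
  by_cases hi : i ∈ C.Iw
  · rcases lt_or_ge (C.thrhi i) (w i) with h | h
    · -- the quotient `(ω̄ - ω) / (ω - ω̄ᵗʰʳ)` is at least `-1`
      have hq : -C.gamhi i ≤ C.gamhi i * (C.whi i - w i) / (w i - C.thrhi i) := by
        rw [le_div_iff₀ (sub_pos.2 h)]
        nlinarith [mul_pos (C.gamhi_pos i hi) (sub_pos.2 (C.lt_whi i hi))]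
      have h5 := le_abs_self (C.gamhi i)
      rw [C.alphaTL_of_thrhi_lt P hi h, abs_of_nonpos (min_le_left _ _), neg_le]
      exact le_min (by linarith) (by linarith)
    · rcases lt_or_ge (w i) (C.thrlo i) with h' | h'
      · have hq : C.gamlo i * (C.wlo i - w i) / (C.thrlo i - w i) ≤ C.gamlo i := by
          rw [div_le_iff₀ (sub_pos.2 h')]
          nlinarith [mul_pos (C.gamlo_pos i hi) (sub_pos.2 (C.wlo_lt i hi))]
        have h5 := le_abs_self (C.gamlo i)
        rw [C.alphaTL_of_lt_thrlo P hi h', abs_of_nonneg (le_max_left _ _)]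
        exact max_le (by linarith) (by linarith)
      · rw [C.alphaTL_of_mem_Icc P ⟨h', h⟩, abs_zero]
        positivity
  · rw [C.alphaTL_of_notMem P hi, abs_zero]
    positivity

/-- The algebraic equation `v = α_TL` of a massless bus is a complementarity condition: either
`v = 0`, or `ω` sits at one end of the safe interval and the sign of `v` is
such that the bus would leave it without the top layer. -/
theorem massless_cases (h : C.alphaTL P x w a i = P.v x w a i) :
    (P.v x w a i = 0 ∧ (i ∈ C.Iw → w i ∈ Set.Icc (C.wlo i) (C.whi i))) ∨
    (i ∈ C.Iw ∧ w i = C.whi i ∧ P.v x w a i ≤ 0) ∨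
    (i ∈ C.Iw ∧ w i = C.wlo i ∧ 0 ≤ P.v x w a i) := by
  by_cases hi : i ∈ C.Iw
  · have hhi : w i ≤ C.whi i := by
      by_contra! hlt
      exact (C.alphaTL_sub_v_neg P hi hlt).ne (sub_eq_zero.2 h)
    have hlo : C.wlo i ≤ w i := by
      by_contra! hlt
      exact (C.alphaTL_sub_v_pos P hi hlt).ne' (sub_eq_zero.2 h)
    by_cases hv : P.v x w a i = 0
    · exact Or.inl ⟨hv, fun _ => ⟨hlo, hhi⟩⟩
    right
    rcases lt_or_ge (C.thrhi i) (w i) with hw | hw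
    · rw [C.alphaTL_of_thrhi_lt P hi hw] at h
      refine Or.inl ⟨hi, hhi.antisymm ?_, h ▸ min_le_left _ _⟩
      by_contra! hlt
      have hq : 0 < C.gamhi i * (C.whi i - w i) / (w i - C.thrhi i) :=
        div_pos (mul_pos (C.gamhi_pos i hi) (sub_pos.2 hlt)) (sub_pos.2 hw)
      rcases min_choice 0 (C.gamhi i * (C.whi i - w i) / (w i - C.thrhi i) + P.v x w a i) with
        h' | h'
      · exact hv (h.symm.trans h')
      · linarith
    · rcases lt_or_ge (w i) (C.thrlo i) with hw' | hw'
      · rw [C.alphaTL_of_lt_thrlo P hi hw'] at h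
        refine Or.inr ⟨hi, le_antisymm ?_ hlo, h ▸ le_max_left _ _⟩
        by_contra! hlt
        have hq : C.gamlo i * (C.wlo i - w i) / (C.thrlo i - w i) < 0 :=
          div_neg_of_neg_of_pos (mul_neg_of_pos_of_neg (C.gamlo_pos i hi) (sub_neg.2 hlt))
            (sub_pos.2 hw')
        rcases max_choice 0 (C.gamlo i * (C.wlo i - w i) / (C.thrlo i - w i) + P.v x w a i) with
          h' | h'
        · exact hv (h.symm.trans h')
        · linarith
      · exact absurd (h.symm.trans (C.alphaTL_of_mem_Icc P ⟨hw', hw⟩)) hv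
  · exact Or.inl ⟨h.symm.trans (C.alphaTL_of_notMem P hi), fun h' => absurd h' hi⟩

theorem massless_mem_Icc (hi : i ∈ C.Iw) (h : C.alphaTL P x w a i = P.v x w a i) :
    w i ∈ Set.Icc (C.wlo i) (C.whi i) := by
  have := C.wlo_neg hi
  have := C.whi_pos hi
  rcases C.massless_cases P h with ⟨-, h'⟩ | ⟨-, h', -⟩ | ⟨-, h', -⟩
  · exact h' hi
  · exact h' ▸ ⟨by linarith, le_rfl⟩
  · exact h' ▸ ⟨le_rfl, by linarith⟩

theorem massless_antitone {x' : G.edgeSet → ℝ} {w' a' : V → ℝ}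
    (h : C.alphaTL P x w a i = P.v x w a i) (h' : C.alphaTL P x' w' a' i = P.v x' w' a' i) :
    (w i - w' i) * (P.v x w a i - P.v x' w' a' i) ≤ 0 := by
  by_cases hi : i ∈ C.Iw
  · obtain ⟨h1, h2⟩ := C.massless_mem_Icc P hi h
    obtain ⟨h3, h4⟩ := C.massless_mem_Icc P hi h'
    rcases C.massless_cases P h with ⟨hv, -⟩ | ⟨-, hw, hv⟩ | ⟨-, hw, hv⟩ <;>
    rcases C.massless_cases P h' with ⟨hv', -⟩ | ⟨-, hw', hv'⟩ | ⟨-, hw', hv'⟩ <;>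
    first
    | exact mul_nonpos_of_nonneg_of_nonpos (by linarith) (by linarith)
    | exact mul_nonpos_of_nonpos_of_nonneg (by linarith) (by linarith)
    | (rw [hv, hv', sub_self, mul_zero])
    | (rw [hw, hw', sub_self, zero_mul])
  · rw [← h, ← h', C.alphaTL_of_notMem P hi, C.alphaTL_of_notMem P hi, sub_self, mul_zero]

/-- The rate at which the closed loop dissipates energy. -/
noncomputable def dissipation (x : G.edgeSet → ℝ) (w a u : V → ℝ) : ℝ :=
  ∑ i, (P.E i * w i ^ 2 - w i * C.alphaTL P x w a i)
    + ∑ i ∈ C.Iu, (1 / C.tau i * a i ^ 2 - a i * C.uHat a u i)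

theorem sq_le_damping (i : V) :
    P.E i * w i ^ 2 ≤ P.E i * w i ^ 2 - w i * C.alphaTL P x w a i := by
  linarith [C.mul_alphaTL_nonpos P (x := x) (w := w) (a := a) (i := i)]

omit [DecidableEq V] [DecidableRel G.Adj] in
/-- By the stability filter the MPC output cannot outweigh the decay of the low-pass filter. -/
theorem sq_le_filter (hi : i ∈ C.Iu) (u : V → ℝ) :
    (1 / C.tau i - C.eps i) * a i ^ 2 ≤ 1 / C.tau i * a i ^ 2 - a i * C.uHat a u i := by
  have h1 := mul_le_mul_of_nonneg_left (C.abs_uHat_le hi a u) (abs_nonneg (a i))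
  have h2 := (le_abs_self (a i * C.uHat a u i)).trans_eq (abs_mul _ _)
  rw [mul_left_comm, abs_mul_abs_self] at h1
  linarith

omit [DecidableEq V] [DecidableRel G.Adj] in
theorem filter_gap_pos (hfilter : ∀ i ∈ C.Iu, C.eps i * C.tau i < 1) (hi : i ∈ C.Iu) :
    0 < 1 / C.tau i - C.eps i :=
  sub_pos.2 ((lt_div_iff₀ (C.tau_pos i hi)).2 (hfilter i hi))

theorem damping_nonneg (i : V) : 0 ≤ P.E i * w i ^ 2 - w i * C.alphaTL P x w a i :=
  (mul_nonneg (P.E_pos i).le (sq_nonneg _)).trans (C.sq_le_damping P i)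

omit [DecidableEq V] [DecidableRel G.Adj] in
theorem filter_nonneg (hfilter : ∀ i ∈ C.Iu, C.eps i * C.tau i < 1) (hi : i ∈ C.Iu)
    (u : V → ℝ) : 0 ≤ 1 / C.tau i * a i ^ 2 - a i * C.uHat a u i :=
  (mul_nonneg (C.filter_gap_pos hfilter hi).le (sq_nonneg _)).trans (C.sq_le_filter hi u)

theorem sq_om_le_dissipation (hfilter : ∀ i ∈ C.Iu, C.eps i * C.tau i < 1) (i : V)
    (u : V → ℝ) : P.E i * w i ^ 2 ≤ C.dissipation P x w a u := by
  have h1 := Finset.single_le_sum (fun j _ => C.damping_nonneg P (x := x) (w := w) (a := a) j)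
    (Finset.mem_univ i)
  have h2 := Finset.sum_nonneg fun j hj => C.filter_nonneg hfilter (a := a) hj u
  have h3 := C.sq_le_damping P (x := x) (w := w) (a := a) i
  unfold dissipation
  linarith

theorem sq_al_le_dissipation (hfilter : ∀ i ∈ C.Iu, C.eps i * C.tau i < 1) (hi : i ∈ C.Iu)
    (u : V → ℝ) : (1 / C.tau i - C.eps i) * a i ^ 2 ≤ C.dissipation P x w a u := by
  have h1 := Finset.sum_nonneg
    fun j (_ : j ∈ Finset.univ) => C.damping_nonneg P (x := x) (w := w) (a := a) j
  have h2 := Finset.single_le_sum (fun j hj => C.filter_nonneg hfilter (a := a) hj u) hi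
  have h3 := C.sq_le_filter (a := a) hi u
  unfold dissipation
  linarith

theorem dissipation_nonneg (hfilter : ∀ i ∈ C.Iu, C.eps i * C.tau i < 1)
    (u : V → ℝ) : 0 ≤ C.dissipation P x w a u :=
  add_nonneg (Finset.sum_nonneg fun i _ => C.damping_nonneg P i)
    (Finset.sum_nonneg fun _ hi => C.filter_nonneg hfilter hi u)

omit [DecidableEq V] [DecidableRel G.Adj] in
theorem exists_sampling_interval {t : ℝ} (ht : 0 ≤ t) :
    ∃ w, t ∈ Set.Ico (C.ts w) (C.ts (w + 1)) := by
  classical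
  have hex : ∃ k, t < C.ts k := (C.ts_tendsto.eventually_gt_atTop t).exists
  have hne : Nat.find hex ≠ 0 := fun h0 => by
    have := Nat.find_spec hex
    rw [h0, C.ts_zero] at this
    exact absurd ht (not_le.2 this)
  obtain ⟨w, hw⟩ := Nat.exists_eq_succ_of_ne_zero hne
  refine ⟨w, not_lt.1 (Nat.find_min hex (by omega)), ?_⟩
  have := Nat.find_spec hex
  rwa [hw] at this

end Controller

end Controller

/-! ### Energy along a solution -/

section Solution

variable {V : Type*} [Fintype V] [DecidableEq V] {G : SimpleGraph V} [DecidableRel G.Adj]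

theorem hasDerivWithinAt_half_mass_mul_sq {m q t : ℝ} {f : ℝ → ℝ} {s : Set ℝ} (hm : 0 ≤ m)
    (hs : UniqueDiffWithinAt ℝ s t) (h : HasDerivWithinAt (fun r => m * f r) q s t) :
    HasDerivWithinAt (fun r => 1 / 2 * (m * f r ^ 2)) (f t * q) s t := by
  rcases hm.eq_or_lt with rfl | hm
  · simp only [zero_mul] at h
    have hq := hs.eq_deriv _ h (hasDerivWithinAt_const t s (0 : ℝ))
    simpa [hq] using hasDerivWithinAt_const t s (0 : ℝ)
  · have h2 := (h.fun_pow 2).const_mul (1 / (2 * m))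
    have hf : (fun r => 1 / 2 * (m * f r ^ 2)) = fun r => 1 / (2 * m) * (m * f r) ^ 2 := by
      funext r
      field_simp
    rw [hf]
    refine h2.congr_deriv ?_
    push_cast
    field_simp

namespace Controller.IsSolution

variable {C : Controller V G} {P : PowerNetwork V G} {lam : ℝ → G.edgeSet → ℝ}
  {om al u : ℝ → V → ℝ} {lamInf : G.edgeSet → ℝ}

theorem continuousOn_lam_apply (h : C.IsSolution P lam om al u) (e : G.edgeSet) :
    ContinuousOn (fun t => lam t e) (Set.Ici 0) := continuousOn_pi.1 h.continuousOn_lam e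

theorem continuousOn_om_apply (h : C.IsSolution P lam om al u) (i : V) :
    ContinuousOn (fun t => om t i) (Set.Ici 0) := continuousOn_pi.1 h.continuousOn_om i

theorem continuousOn_al_apply (h : C.IsSolution P lam om al u) (i : V) :
    ContinuousOn (fun t => al t i) (Set.Ici 0) := continuousOn_pi.1 h.continuousOn_al i

theorem hasDerivWithinAt_mass_mul_om (h : C.IsSolution P lam om al u) (i : V) (t : ℝ)
    (ht : 0 ≤ t) :
    HasDerivWithinAt (fun s => P.M i * om s i)
      (C.alphaTL P (lam t) (om t) (al t) i - P.v (lam t) (om t) (al t) i) (Set.Ici t) t := by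
  refine (h.swing t ht i).congr_deriv ?_
  simp only [Controller.alpha, PowerNetwork.v, Pi.add_apply]
  ring

theorem hasDerivWithinAt_om (h : C.IsSolution P lam om al u) {i : V} (hi : 0 < P.M i) (t : ℝ)
    (ht : 0 ≤ t) :
    HasDerivWithinAt (fun s => om s i)
      ((P.M i)⁻¹ * (C.alphaTL P (lam t) (om t) (al t) i - P.v (lam t) (om t) (al t) i))
      (Set.Ici t) t := by
  simpa [inv_mul_cancel_left₀ hi.ne'] using
    (h.hasDerivWithinAt_mass_mul_om i t ht).const_mul (P.M i)⁻¹

theorem alphaTL_eq_v (h : C.IsSolution P lam om al u) {i : V} (hi : P.M i = 0) {t : ℝ}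
    (ht : 0 ≤ t) :
    C.alphaTL P (lam t) (om t) (al t) i = P.v (lam t) (om t) (al t) i := by
  have h1 := h.hasDerivWithinAt_mass_mul_om i t ht
  simp only [hi, zero_mul] at h1
  exact sub_eq_zero.1 ((uniqueDiffOn_Ici t t Set.self_mem_Ici).eq_deriv _ h1
    (hasDerivWithinAt_const t (Set.Ici t) (0 : ℝ)))

theorem mem_rangeD (h : C.IsSolution P lam om al u) {t : ℝ} (ht : 0 ≤ t) :
    lam t ∈ P.rangeD := by
  have h0 := h.initial
  rw [P.rangeD_eq_range_mulVecLin, SetLike.mem_coe] at h0 ⊢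
  by_contra hnot
  -- a functional vanishing on the range of `D` is constant along the solution
  obtain ⟨f, hf, hfD⟩ := Submodule.exists_dual_map_eq_bot_of_notMem hnot inferInstance
  have hker : ∀ y ∈ LinearMap.range P.D.mulVecLin, f y = 0 := fun y hy => by
    simpa [hfD] using Submodule.mem_map_of_mem (f := f) hy
  have hfc : Continuous f := f.continuous_of_finiteDimensional
  have hconst := constant_of_has_deriv_right_zero (f := fun s => f (lam s)) (a := 0) (b := t)
    (hfc.comp_continuousOn (h.continuousOn_lam.mono fun s hs => hs.1)) (fun s hs => by
      have h1 := (LinearMap.toContinuousLinearMap f).hasFDerivAt.comp_hasDerivWithinAt s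
        (hasDerivWithinAt_pi.2 (h.angle s hs.1))
      refine h1.congr_deriv ?_
      exact hker _ ⟨om s, rfl⟩) t ⟨ht, le_rfl⟩
  exact hf (hconst.trans (hker _ h0))

/-- Energy balance. The terms `ω · α_BL` and `ω · flow` cancel between the swing equation, the
filters and the angle dynamics. At massless buses only the derivative of `M ω ^ 2 = 0` is needed. -/
theorem hasDerivWithinAt_energy (h : C.IsSolution P lam om al u)
    (heq : P.flow lamInf = P.p) (t : ℝ) (ht : 0 ≤ t) :
    HasDerivWithinAt (fun s => C.energy P lamInf (lam s) (om s) (al s))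
      (-C.dissipation P (lam t) (om t) (al t) (u t)) (Set.Ici t) t := by
  have hK := HasDerivWithinAt.fun_sum (u := Finset.univ) fun i _ =>
    hasDerivWithinAt_half_mass_mul_sq (P.M_nonneg i) (uniqueDiffOn_Ici t t Set.self_mem_Ici)
      (h.hasDerivWithinAt_mass_mul_om i t ht)
  have hW := HasDerivWithinAt.fun_sum (u := Finset.univ) fun e _ =>
    ((((h.angle t ht e).cos.const_sub (Real.cos (lamInf e))).sub
      ((h.angle t ht e).mul_const (Real.sin (lamInf e)))).add_const
        (lamInf e * Real.sin (lamInf e))).const_mul (P.b e)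
  have hA := HasDerivWithinAt.fun_sum (u := C.Iu) fun i hi =>
    ((h.lowPass t ht i hi).fun_pow 2).const_mul (1 / 2)
  simp only [Controller.energy, Finset.mul_sum]
  refine ((hK.add hW).add hA).congr_deriv ?_
  have hflow : ∑ e, P.b e * (- (-Real.sin (lam t e) * (P.D *ᵥ om t) e)
      - (P.D *ᵥ om t) e * Real.sin (lamInf e)) =
      ∑ i, om t i * (P.flow (lam t) i - P.p i) := by
    simp only [mul_sub, Finset.sum_sub_distrib, P.sum_mul_flow]
    rw [← heq, P.sum_mul_flow, ← Finset.sum_sub_distrib, ← Finset.sum_sub_distrib]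
    exact Finset.sum_congr rfl fun e _ => by ring
  -- buses without a filter have `α_BL = 0`
  have hcross : ∑ i, om t i * al t i = ∑ i ∈ C.Iu, om t i * al t i :=
    (Finset.sum_subset (Finset.subset_univ _) fun i _ hi => by
      rw [h.lowPass_zero t ht i hi, mul_zero]).symm
  have hbus : ∑ i, om t i * (C.alphaTL P (lam t) (om t) (al t) i
      - P.v (lam t) (om t) (al t) i) =
      -∑ i, (P.E i * om t i ^ 2 - om t i * C.alphaTL P (lam t) (om t) (al t) i)
        - ∑ i, om t i * (P.flow (lam t) i - P.p i) + ∑ i, om t i * al t i := by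
    rw [← Finset.sum_neg_distrib, ← Finset.sum_sub_distrib, ← Finset.sum_add_distrib]
    refine Finset.sum_congr rfl fun i _ => ?_
    simp only [PowerNetwork.v]
    ring
  have hfil : ∑ i ∈ C.Iu, 1 / 2 * (((2 : ℕ) : ℝ) * al t i ^ (2 - 1) *
      (-(1 / C.tau i) * al t i - om t i + C.uHat (al t) (u t) i)) =
      -∑ i ∈ C.Iu, (1 / C.tau i * al t i ^ 2 - al t i * C.uHat (al t) (u t) i)
        - ∑ i ∈ C.Iu, om t i * al t i := by
    rw [← Finset.sum_neg_distrib, ← Finset.sum_sub_distrib]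
    refine Finset.sum_congr rfl fun i _ => ?_
    push_cast
    ring
  rw [hbus, hflow, hfil, hcross, Controller.dissipation]
  ring

theorem continuousOn_energy (h : C.IsSolution P lam om al u) (lamInf : G.edgeSet → ℝ) :
    ContinuousOn (fun t => C.energy P lamInf (lam t) (om t) (al t)) (Set.Ici 0) := by
  have h1 := h.continuousOn_lam_apply
  have h2 := h.continuousOn_om_apply
  have h3 := h.continuousOn_al_apply
  unfold Controller.energy
  fun_prop

theorem energy_le (h : C.IsSolution P lam om al u) (hfilter : ∀ i ∈ C.Iu, C.eps i * C.tau i < 1)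
    (heq : P.flow lamInf = P.p) {s t : ℝ} (hs : 0 ≤ s) (hst : s ≤ t) :
    C.energy P lamInf (lam t) (om t) (al t) ≤ C.energy P lamInf (lam s) (om s) (al s) := by
  have := sub_le_mul_of_deriv_right_le (c := 0) (h.continuousOn_energy lamInf)
    (h.hasDerivWithinAt_energy heq) hs hst
    fun x _ => neg_nonpos.2 (C.dissipation_nonneg P hfilter _)
  linarith

/-- The energy barrier keeps the angle differences away from the boundary of `Υ`. -/
theorem mem_Upsilon (h : C.IsSolution P lam om al u)
    (hfilter : ∀ i ∈ C.Iu, C.eps i * C.tau i < 1) (hInf : P.IsSyncEquilibrium lamInf) {ρ : ℝ}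
    (hρ : ρ < 1) (h0 : (lam 0, om 0, al 0) ∈ C.level P lamInf ρ) {t : ℝ} (ht : 0 ≤ t) :
    lam t ∈ Upsilon G := by
  have hfront : ∀ s, 0 ≤ s → lam s ∉ frontier (Upsilon G) := fun s hs hmem => by
    have h1 := C.lt_energy_of_mem_frontier P hInf.mem_Upsilon hmem (om s) (al s) hρ
    have h2 := h.energy_le hfilter hInf.equilibrium le_rfl hs
    exact absurd (h2.trans h0.2) (not_le.2 h1)
  have hsplit : ∀ s, 0 ≤ s → lam s ∈ Upsilon G ∪ (closure (Upsilon G))ᶜ := fun s hs => by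
    by_contra hnot
    rw [Set.mem_union, Set.mem_compl_iff, not_or, not_not] at hnot
    refine hfront s hs ?_
    rw [isOpen_Upsilon.frontier_eq]
    exact ⟨hnot.2, hnot.1⟩
  have hpre : IsPreconnected (lam '' Set.Icc 0 t) :=
    isPreconnected_Icc.image _ (h.continuousOn_lam.mono fun s hs => hs.1)
  refine hpre.subset_left_of_subset_union isOpen_Upsilon isClosed_closure.isOpen_compl
    (Set.disjoint_compl_right_iff_subset.2 subset_closure) ?_ ?_ ⟨t, ⟨ht, le_rfl⟩, rfl⟩
  · rintro _ ⟨s, hs, rfl⟩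
    exact hsplit s hs.1
  · exact ⟨lam 0, ⟨0, ⟨le_rfl, ht⟩, rfl⟩, (hsplit 0 le_rfl).resolve_right fun hc => hc h0.1⟩

end Controller.IsSolution

end Solution

/-! ### Boundedness and Lipschitz continuity of solutions -/

section Solution

variable {V : Type*} [Fintype V] [DecidableEq V] {G : SimpleGraph V} [DecidableRel G.Adj]

namespace Controller

variable (C : Controller V G) (P : PowerNetwork V G) {lamInf : G.edgeSet → ℝ}

omit [DecidableEq V] in
theorem mass_mul_sq_le_energy (hInf : lamInf ∈ Upsilon G) {x : G.edgeSet → ℝ}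
    (hx : x ∈ Upsilon G) (w a : V → ℝ) (i : V) :
    P.M i * w i ^ 2 ≤ 2 * C.energy P lamInf x w a := by
  have h1 := Finset.single_le_sum
    (fun j _ => mul_nonneg (P.M_nonneg j) (sq_nonneg (w j))) (Finset.mem_univ i)
  have h2 := P.potential_nonneg hInf (subset_closure hx)
  have h3 : 0 ≤ ∑ j ∈ C.Iu, a j ^ 2 := Finset.sum_nonneg fun j _ => sq_nonneg (a j)
  unfold energy
  linarith

omit [DecidableEq V] in
theorem sq_le_energy (hInf : lamInf ∈ Upsilon G) {x : G.edgeSet → ℝ}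
    (hx : x ∈ Upsilon G) (w a : V → ℝ) {i : V} (hi : i ∈ C.Iu) :
    a i ^ 2 ≤ 2 * C.energy P lamInf x w a := by
  have h1 := Finset.single_le_sum (fun j (_ : j ∈ C.Iu) => sq_nonneg (a j)) hi
  have h2 := P.potential_nonneg hInf (subset_closure hx)
  have h3 : 0 ≤ ∑ j, P.M j * w j ^ 2 :=
    Finset.sum_nonneg fun j _ => mul_nonneg (P.M_nonneg j) (sq_nonneg (w j))
  unfold energy
  linarith

end Controller

namespace Controller.IsSolution

variable {C : Controller V G} {P : PowerNetwork V G} {lam : ℝ → G.edgeSet → ℝ}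
  {om al u : ℝ → V → ℝ} {lamInf : G.edgeSet → ℝ}

theorem bounded_al (h : C.IsSolution P lam om al u)
    (hfilter : ∀ i ∈ C.Iu, C.eps i * C.tau i < 1) (hInf : P.IsSyncEquilibrium lamInf)
    (hΥ : ∀ t, 0 ≤ t → lam t ∈ Upsilon G) (i : V) : HalfLineBounded fun t => al t i := by
  by_cases hi : i ∈ C.Iu
  · refine HalfLineBounded.of_sq ⟨2 * C.energy P lamInf (lam 0) (om 0) (al 0), fun t ht => ?_⟩
    rw [abs_of_nonneg (sq_nonneg _)]
    linarith [C.sq_le_energy P hInf.mem_Upsilon (hΥ t ht) (om t) (al t) hi,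
      h.energy_le hfilter hInf.equilibrium le_rfl ht]
  · exact (HalfLineBounded.const 0).mono fun t ht => by rw [h.lowPass_zero t ht i hi]

theorem bounded_flow (hΥ : ∀ t, 0 ≤ t → lam t ∈ Upsilon G) (P : PowerNetwork V G) (i : V) :
    HalfLineBounded fun t => P.flow (lam t) i := by
  obtain ⟨K, hK⟩ := isCompact_closure_Upsilon.exists_bound_of_continuousOn
    (continuous_pi_iff.1 P.continuous_flow i).continuousOn
  exact ⟨K, fun t ht => hK _ (subset_closure (hΥ t ht))⟩

/-- At buses with inertia the energy bounds the frequency; at massless buses the algebraic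
equation does. -/
theorem bounded_om (h : C.IsSolution P lam om al u)
    (hfilter : ∀ i ∈ C.Iu, C.eps i * C.tau i < 1) (hInf : P.IsSyncEquilibrium lamInf)
    (hΥ : ∀ t, 0 ≤ t → lam t ∈ Upsilon G) (i : V) : HalfLineBounded fun t => om t i := by
  rcases (P.M_nonneg i).eq_or_lt with hM | hM
  · refine (((((bounded_flow hΥ P i).sub (HalfLineBounded.const (P.p i))).sub
      (h.bounded_al hfilter hInf hΥ i)).const_mul (P.E i)⁻¹)).mono fun t ht => ?_
    have hE := P.E_pos i
    have h1 := h.alphaTL_eq_v hM.symm ht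
    have h2 := C.mul_alphaTL_nonpos P (x := lam t) (w := om t) (a := al t) (i := i)
    rw [h1] at h2
    rw [abs_mul, abs_inv, abs_of_pos hE, ← div_eq_inv_mul, le_div_iff₀ hE, mul_comm]
    set φ := P.flow (lam t) i - P.p i - al t i with hφ
    have h3 : P.v (lam t) (om t) (al t) i = P.E i * om t i + φ := by
      simp only [PowerNetwork.v, hφ]
      ring
    rw [h3] at h2
    rcases (abs_nonneg (om t i)).eq_or_lt with h0 | h0
    · rw [← h0, mul_zero]
      exact abs_nonneg _
    · refine le_of_mul_le_mul_left ?_ h0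
      have h4 := neg_abs_le (om t i * φ)
      rw [abs_mul] at h4
      rw [mul_left_comm, abs_mul_abs_self]
      linarith
  · refine HalfLineBounded.of_sq
      ⟨2 * C.energy P lamInf (lam 0) (om 0) (al 0) / P.M i, fun t ht => ?_⟩
    rw [abs_of_nonneg (sq_nonneg _), le_div_iff₀ hM, mul_comm]
    linarith [C.mass_mul_sq_le_energy P hInf.mem_Upsilon (hΥ t ht) (om t) (al t) i,
      h.energy_le hfilter hInf.equilibrium le_rfl ht]

theorem lipschitz_lam (h : C.IsSolution P lam om al u)
    (hfilter : ∀ i ∈ C.Iu, C.eps i * C.tau i < 1) (hInf : P.IsSyncEquilibrium lamInf)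
    (hΥ : ∀ t, 0 ≤ t → lam t ∈ Upsilon G) (e : G.edgeSet) :
    HalfLineLipschitz fun t => lam t e :=
  .of_deriv_bounded (h.continuousOn_lam_apply e) (fun t ht => h.angle t ht e)
    (.sum _ fun i _ => (h.bounded_om hfilter hInf hΥ i).const_mul (P.D e i))

theorem lipschitz_flow (h : C.IsSolution P lam om al u)
    (hfilter : ∀ i ∈ C.Iu, C.eps i * C.tau i < 1) (hInf : P.IsSyncEquilibrium lamInf)
    (hΥ : ∀ t, 0 ≤ t → lam t ∈ Upsilon G) (i : V) :
    HalfLineLipschitz fun t => P.flow (lam t) i := by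
  simp only [P.flow_apply]
  exact .sum _ fun e _ => (((h.lipschitz_lam hfilter hInf hΥ e).sin).const_mul _).const_mul _

theorem lipschitz_al (h : C.IsSolution P lam om al u)
    (hfilter : ∀ i ∈ C.Iu, C.eps i * C.tau i < 1) (hInf : P.IsSyncEquilibrium lamInf)
    (hΥ : ∀ t, 0 ≤ t → lam t ∈ Upsilon G) (i : V) :
    HalfLineLipschitz fun t => al t i := by
  by_cases hi : i ∈ C.Iu
  · have hal := h.bounded_al hfilter hInf hΥ i
    refine .of_deriv_bounded (h.continuousOn_al_apply i) (fun t ht => h.lowPass t ht i hi)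
      (((hal.const_mul _).sub (h.bounded_om hfilter hInf hΥ i)).add
        ((hal.abs.const_mul (C.eps i)).mono fun t _ => ?_))
    exact (C.abs_uHat_le hi (al t) (u t)).trans (le_abs_self _)
  · exact (HalfLineLipschitz.const 0).mono fun s hs t ht => by
      rw [h.lowPass_zero t ht i hi, h.lowPass_zero s hs i hi]

theorem lipschitz_om (h : C.IsSolution P lam om al u)
    (hfilter : ∀ i ∈ C.Iu, C.eps i * C.tau i < 1) (hInf : P.IsSyncEquilibrium lamInf)
    (hΥ : ∀ t, 0 ≤ t → lam t ∈ Upsilon G) (i : V) :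
    HalfLineLipschitz fun t => om t i := by
  rcases (P.M_nonneg i).eq_or_lt with hM | hM
  · -- the algebraic equation makes `ω` a Lipschitz function of `flow - p - α_BL`
    refine (((((h.lipschitz_flow hfilter hInf hΥ i).sub (HalfLineLipschitz.const (P.p i))).sub
      (h.lipschitz_al hfilter hInf hΥ i)).const_mul (P.E i)⁻¹)).mono fun s hs t ht => ?_
    have hE := P.E_pos i
    have h2 := C.massless_antitone P (h.alphaTL_eq_v hM.symm hs) (h.alphaTL_eq_v hM.symm ht)
    rw [← mul_sub, abs_mul, abs_inv, abs_of_pos hE, ← div_eq_inv_mul, le_div_iff₀ hE, mul_comm]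
    set ψ := P.flow (lam s) i - P.p i - al s i - (P.flow (lam t) i - P.p i - al t i) with hψ
    have h3 : P.v (lam s) (om s) (al s) i - P.v (lam t) (om t) (al t) i =
        P.E i * (om s i - om t i) + ψ := by
      simp only [PowerNetwork.v, hψ]
      ring
    rw [h3] at h2
    rcases (abs_nonneg (om s i - om t i)).eq_or_lt with h0 | h0
    · rw [← h0, mul_zero]
      exact abs_nonneg _
    · refine le_of_mul_le_mul_left ?_ h0
      have h4 := neg_abs_le ((om s i - om t i) * ψ)
      rw [abs_mul] at h4
      rw [mul_left_comm, abs_mul_abs_self]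
      linarith
  · have hv : HalfLineBounded fun t => P.v (lam t) (om t) (al t) i :=
      ((((h.bounded_om hfilter hInf hΥ i).const_mul (P.E i)).add (bounded_flow hΥ P i)).sub
        (HalfLineBounded.const (P.p i))).sub (h.bounded_al hfilter hInf hΥ i)
    have ha : HalfLineBounded fun t => C.alphaTL P (lam t) (om t) (al t) i :=
      ((HalfLineBounded.const (|C.gamhi i| + |C.gamlo i|)).add hv.abs).mono fun t _ =>
        (C.abs_alphaTL_le P).trans (le_abs_self _)
    exact .of_deriv_bounded (h.continuousOn_om_apply i) (h.hasDerivWithinAt_om hM)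
      ((ha.sub hv).const_mul _)

/-! ### Convergence -/

theorem exists_tendsto_energy (h : C.IsSolution P lam om al u)
    (hfilter : ∀ i ∈ C.Iu, C.eps i * C.tau i < 1) (hInf : P.IsSyncEquilibrium lamInf)
    (hΥ : ∀ t, 0 ≤ t → lam t ∈ Upsilon G) :
    ∃ l, Tendsto (fun t => C.energy P lamInf (lam t) (om t) (al t)) atTop (𝓝 l) := by
  set g : ℝ → ℝ := fun t => C.energy P lamInf (lam (max t 0)) (om (max t 0)) (al (max t 0))
  have hanti : Antitone g := fun s t hst =>
    h.energy_le hfilter hInf.equilibrium (le_max_right _ _) (max_le_max_right 0 hst)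
  have hbdd : BddBelow (Set.range g) := by
    refine ⟨0, ?_⟩
    rintro _ ⟨t, rfl⟩
    obtain ⟨i, hi⟩ := P.exists_M_pos
    have := C.mass_mul_sq_le_energy P hInf.mem_Upsilon (hΥ _ (le_max_right t 0))
      (om (max t 0)) (al (max t 0)) i
    linarith [mul_nonneg hi.le (sq_nonneg (om (max t 0) i))]
  refine ⟨_, (tendsto_atTop_ciInf hanti hbdd).congr' ?_⟩
  filter_upwards [eventually_ge_atTop 0] with t ht
  simp only [g, max_eq_left ht]

/-- A signal whose square is dominated by the dissipation vanishes at infinity. -/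
theorem tendsto_zero_of_sq_le_dissipation (h : C.IsSolution P lam om al u)
    (hfilter : ∀ i ∈ C.Iu, C.eps i * C.tau i < 1) (hInf : P.IsSyncEquilibrium lamInf)
    (hΥ : ∀ t, 0 ≤ t → lam t ∈ Upsilon G) {f : ℝ → ℝ} {κ : ℝ} (hκ : 0 < κ)
    (hb : HalfLineBounded f) (hl : HalfLineLipschitz f)
    (hle : ∀ t, 0 ≤ t → κ * f t ^ 2 ≤ C.dissipation P (lam t) (om t) (al t) (u t)) :
    Tendsto f atTop (𝓝 0) := by
  obtain ⟨l, hlim⟩ := h.exists_tendsto_energy hfilter hInf hΥ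
  rw [Metric.tendsto_nhds]
  intro ε hε
  have := eventually_lt_of_deriv_right_le (f := fun t => κ * f t ^ 2) (r := fun _ => 0)
    (ε := κ * ε ^ 2)
    (h.continuousOn_energy lamInf) (h.hasDerivWithinAt_energy hInf.equilibrium)
    (by filter_upwards [eventually_ge_atTop 0] with t ht using by linarith [hle t ht])
    ((hl.sq hb).const_mul κ) tendsto_const_nhds hlim (by positivity)
  filter_upwards [this] with t ht
  rw [Real.dist_eq, sub_zero]
  exact abs_lt_of_sq_lt_sq (lt_of_mul_lt_mul_left ht hκ.le) hε.le

theorem tendsto_om (h : C.IsSolution P lam om al u)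
    (hfilter : ∀ i ∈ C.Iu, C.eps i * C.tau i < 1) (hInf : P.IsSyncEquilibrium lamInf)
    (hΥ : ∀ t, 0 ≤ t → lam t ∈ Upsilon G) : Tendsto om atTop (𝓝 0) :=
  tendsto_pi_nhds.2 fun i => h.tendsto_zero_of_sq_le_dissipation hfilter hInf hΥ (P.E_pos i)
    (h.bounded_om hfilter hInf hΥ i) (h.lipschitz_om hfilter hInf hΥ i)
    fun _ _ => C.sq_om_le_dissipation P hfilter i _

theorem tendsto_al (h : C.IsSolution P lam om al u)
    (hfilter : ∀ i ∈ C.Iu, C.eps i * C.tau i < 1) (hInf : P.IsSyncEquilibrium lamInf)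
    (hΥ : ∀ t, 0 ≤ t → lam t ∈ Upsilon G) : Tendsto al atTop (𝓝 0) := by
  refine tendsto_pi_nhds.2 fun i => ?_
  by_cases hi : i ∈ C.Iu
  · exact h.tendsto_zero_of_sq_le_dissipation hfilter hInf hΥ (C.filter_gap_pos hfilter hi)
      (h.bounded_al hfilter hInf hΥ i) (h.lipschitz_al hfilter hInf hΥ i)
      fun _ _ => C.sq_al_le_dissipation P hfilter hi _
  · refine tendsto_const_nhds.congr' ?_
    filter_upwards [eventually_ge_atTop 0] with t ht using (h.lowPass_zero t ht i hi).symm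

theorem eventually_alphaTL_eq_zero (C : Controller V G) (P : PowerNetwork V G)
    (hom : Tendsto om atTop (𝓝 0)) (i : V) :
    ∀ᶠ t in atTop, C.alphaTL P (lam t) (om t) (al t) i = 0 := by
  by_cases hi : i ∈ C.Iw
  · have := tendsto_pi_nhds.1 hom i
    filter_upwards [this.eventually_lt_const (C.thrhi_pos i hi),
      this.eventually_const_lt (C.thrlo_neg i hi)] with t h1 h2
    exact C.alphaTL_of_mem_Icc P ⟨h2.le, h1.le⟩
  · exact .of_forall fun t => C.alphaTL_of_notMem P hi

/-- The swing equation with `ω → 0`, `α → 0` forces the flow to balance the injection. -/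
theorem tendsto_flow (h : C.IsSolution P lam om al u)
    (hfilter : ∀ i ∈ C.Iu, C.eps i * C.tau i < 1) (hInf : P.IsSyncEquilibrium lamInf)
    (hΥ : ∀ t, 0 ≤ t → lam t ∈ Upsilon G) :
    Tendsto (fun t => P.flow (lam t)) atTop (𝓝 P.p) := by
  refine tendsto_pi_nhds.2 fun i => ?_
  have hom := h.tendsto_om hfilter hInf hΥ
  have homi := tendsto_pi_nhds.1 hom i
  have hali := tendsto_pi_nhds.1 (h.tendsto_al hfilter hInf hΥ) i
  have hflow := (h.lipschitz_flow hfilter hInf hΥ i).sub (.const (P.p i))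
  have hα := eventually_alphaTL_eq_zero (lam := lam) (al := al) C P hom i
  have hr : Tendsto (fun t => al t i - P.E i * om t i) atTop (𝓝 0) := by
    simpa using hali.sub (homi.const_mul (P.E i))
  have hlim : Tendsto (fun t => P.M i * om t i) atTop (𝓝 0) := by
    simpa using homi.const_mul (P.M i)
  have hcont : ContinuousOn (fun t => P.M i * om t i) (Set.Ici 0) :=
    continuousOn_const.mul (h.continuousOn_om_apply i)
  rw [Metric.tendsto_nhds]
  intro ε hε
  filter_upwards [
    eventually_lt_of_deriv_right_le hcont (h.hasDerivWithinAt_mass_mul_om i)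
      (by filter_upwards [hα] with t ht
          rw [ht, PowerNetwork.v]
          linarith) hflow hr hlim hε,
    eventually_lt_of_deriv_right_le (f := fun t => -1 * (P.flow (lam t) i - P.p i))
      (r := fun t => -(al t i - P.E i * om t i)) hcont.neg
      (fun t ht => (h.hasDerivWithinAt_mass_mul_om i t ht).neg)
      (by filter_upwards [hα] with t ht
          rw [ht, PowerNetwork.v]
          linarith) (hflow.const_mul (-1)) (by simpa using hr.neg) hlim.neg hε] with t h1 h2
  rw [Real.dist_eq, abs_lt]
  exact ⟨by linarith, h1⟩

theorem tendsto_lam (h : C.IsSolution P lam om al u)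
    (hfilter : ∀ i ∈ C.Iu, C.eps i * C.tau i < 1) (hInf : P.IsSyncEquilibrium lamInf)
    (hΥ : ∀ t, 0 ≤ t → lam t ∈ Upsilon G) : Tendsto lam atTop (𝓝 lamInf) := by
  refine isCompact_closure_Upsilon.inter_right P.isClosed_rangeD
    |>.tendsto_nhds_of_unique_mapClusterPt ?_ fun y hy hcl => ?_
  · filter_upwards [eventually_ge_atTop 0] with t ht using
      ⟨subset_closure (hΥ t ht), h.mem_rangeD ht⟩
  · refine P.eq_of_flow_eq hy.2 hInf.mem_rangeD (closure_Upsilon_subset hy.1)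
      (fun e => (hInf.mem_Upsilon e).le) ?_
    rw [hInf.equilibrium]
    have h1 := hcl.continuousAt_comp P.continuous_flow.continuousAt
    exact eq_of_nhds_neBot (h1.neBot.mono (inf_le_inf_left _ (h.tendsto_flow hfilter hInf hΥ)))

theorem u_eq_zero (h : C.IsSolution P lam om al u) {i : V} (hi : i ∉ C.Iu) {t : ℝ}
    (ht : 0 ≤ t) : u t i = 0 := by
  obtain ⟨w, hw⟩ := C.exists_sampling_interval ht
  obtain ⟨X, S, hopt, -⟩ := h.mpc w
  rw [h.mpc_hold w t hw]
  exact hopt.mem_admissible i hi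

theorem tendsto_uHat (h : C.IsSolution P lam om al u) (hal : Tendsto al atTop (𝓝 0)) :
    Tendsto (fun t => C.uHat (al t) (u t)) atTop (𝓝 0) := by
  refine tendsto_pi_nhds.2 fun i => ?_
  by_cases hi : i ∈ C.Iu
  · have h1 : Tendsto (fun t => C.eps i * |al t i|) atTop (𝓝 0) := by
      simpa using (tendsto_pi_nhds.1 hal i).abs.const_mul (C.eps i)
    exact squeeze_zero_norm (fun t => C.abs_uHat_le hi (al t) (u t)) h1
  · refine tendsto_const_nhds.congr' ?_
    filter_upwards [eventually_ge_atTop 0] with t ht using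
      (C.uHat_eq_zero (h.lowPass_zero t ht i hi) (h.u_eq_zero hi ht)).symm

/-- The sensitivity constraint bounds the held MPC output by the filter state at the last sampling
time, which tends to infinity with `t`. -/
theorem tendsto_u (h : C.IsSolution P lam om al u) (hal : Tendsto al atTop (𝓝 0)) :
    Tendsto u atTop (𝓝 0) := by
  refine tendsto_pi_nhds.2 fun i => ?_
  by_cases hi : i ∈ C.Iu
  · have h1 : Tendsto (fun t => C.eps i * |al t i|) atTop (𝓝 0) := by
      simpa using (tendsto_pi_nhds.1 hal i).abs.const_mul (C.eps i)
    rw [Metric.tendsto_nhds]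
    intro ε hε
    obtain ⟨T, hT⟩ := eventually_atTop.1 (h1.eventually_lt_const hε)
    obtain ⟨w₀, hw₀⟩ := eventually_atTop.1 (C.ts_tendsto.eventually_ge_atTop T)
    filter_upwards [eventually_ge_atTop 0, eventually_ge_atTop (C.ts w₀)] with t ht htw
    obtain ⟨w, hw⟩ := C.exists_sampling_interval ht
    have hww : w₀ ≤ w := Nat.lt_succ_iff.1 (C.ts_strictMono.lt_iff_lt.1 (htw.trans_lt hw.2))
    obtain ⟨X, S, hopt, -⟩ := h.mpc w
    rw [Real.dist_eq, Pi.zero_apply, sub_zero, h.mpc_hold w t hw]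
    exact (hopt.sensitivity i hi).trans_lt (hT _ (hw₀ w hww))
  · refine tendsto_const_nhds.congr' ?_
    filter_upwards [eventually_ge_atTop 0] with t ht using (h.u_eq_zero hi ht).symm

end Controller.IsSolution

end Solution

/-! ### Safe frequency intervals -/

section Solution

variable {V : Type*} [Fintype V] [DecidableEq V] {G : SimpleGraph V} [DecidableRel G.Adj]

namespace Controller.IsSolution

variable {C : Controller V G} {P : PowerNetwork V G} {lam : ℝ → G.edgeSet → ℝ}
  {om al u : ℝ → V → ℝ}

theorem om_le_whi (h : C.IsSolution P lam om al u) {i : V} (hi : i ∈ C.Iw) {s : ℝ} (hs : 0 ≤ s)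
    (h0 : om s i ≤ C.whi i) : ∀ t, s ≤ t → om t i ≤ C.whi i := by
  rcases (P.M_nonneg i).eq_or_lt with hM | hM
  · exact fun t ht => (C.massless_mem_Icc P hi (h.alphaTL_eq_v hM.symm (hs.trans ht))).2
  · exact le_of_deriv_right_nonpos_of_le (h.continuousOn_om_apply i) (h.hasDerivWithinAt_om hM)
      (fun t _ hB => mul_nonpos_of_nonneg_of_nonpos (inv_pos.2 hM).le
        (C.alphaTL_sub_v_nonpos P hi hB)) hs h0

theorem wlo_le_om (h : C.IsSolution P lam om al u) {i : V} (hi : i ∈ C.Iw) {s : ℝ} (hs : 0 ≤ s)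
    (h0 : C.wlo i ≤ om s i) : ∀ t, s ≤ t → C.wlo i ≤ om t i := by
  rcases (P.M_nonneg i).eq_or_lt with hM | hM
  · exact fun t ht => (C.massless_mem_Icc P hi (h.alphaTL_eq_v hM.symm (hs.trans ht))).1
  · intro t ht
    exact neg_le_neg_iff.1 <| le_of_deriv_right_nonpos_of_le (h.continuousOn_om_apply i).neg
      (fun t ht => (h.hasDerivWithinAt_om hM t ht).neg)
      (fun t _ hB => neg_nonpos.2 (mul_nonneg (inv_pos.2 hM).le
        (C.alphaTL_sub_v_nonneg P hi (neg_le_neg_iff.1 hB)))) hs (neg_le_neg h0) t ht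

theorem exists_entrance_from_above (h : C.IsSolution P lam om al u) {i : V} (hi : i ∈ C.Iw)
    (hom : Tendsto om atTop (𝓝 0)) (h0 : C.whi i < om 0 i) :
    ∃ t₀, 0 < t₀ ∧ (∀ t ∈ Set.Ico 0 t₀, C.whi i < om t i) ∧
      (∀ t, t₀ ≤ t → om t i ∈ Set.Icc (C.wlo i) (C.whi i)) ∧
      StrictAntiOn (fun t => om t i) (Set.Icc 0 t₀) := by
  have hM : 0 < P.M i := (P.M_nonneg i).lt_of_ne fun hM =>
    absurd h0 (not_lt.2 (C.massless_mem_Icc P hi (h.alphaTL_eq_v hM.symm le_rfl)).2)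
  obtain ⟨t₀, hpos, hout, hin⟩ := exists_entrance_time (h.continuousOn_om_apply i) h0
    ((tendsto_pi_nhds.1 hom i).eventually_lt_const (C.whi_pos hi))
  have hlo : C.wlo i ≤ om 0 i := by linarith [C.wlo_neg hi, C.whi_pos hi]
  exact ⟨t₀, hpos, hout, fun t ht =>
    ⟨h.wlo_le_om hi le_rfl hlo t (hpos.le.trans ht), h.om_le_whi hi hpos.le hin t ht⟩,
    strictAntiOn_of_deriv_right_neg (h.continuousOn_om_apply i) (h.hasDerivWithinAt_om hM)
      fun t ht => mul_neg_of_pos_of_neg (inv_pos.2 hM) (C.alphaTL_sub_v_neg P hi (hout t ht))⟩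

theorem exists_entrance_from_below (h : C.IsSolution P lam om al u) {i : V} (hi : i ∈ C.Iw)
    (hom : Tendsto om atTop (𝓝 0)) (h0 : om 0 i < C.wlo i) :
    ∃ t₀, 0 < t₀ ∧ (∀ t ∈ Set.Ico 0 t₀, om t i < C.wlo i) ∧
      (∀ t, t₀ ≤ t → om t i ∈ Set.Icc (C.wlo i) (C.whi i)) ∧
      StrictMonoOn (fun t => om t i) (Set.Icc 0 t₀) := by
  have hM : 0 < P.M i := (P.M_nonneg i).lt_of_ne fun hM =>
    absurd h0 (not_lt.2 (C.massless_mem_Icc P hi (h.alphaTL_eq_v hM.symm le_rfl)).1)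
  have hcont : ContinuousOn (fun t => -om t i) (Set.Ici 0) := (h.continuousOn_om_apply i).neg
  obtain ⟨t₀, hpos, hout, hin⟩ := exists_entrance_time hcont (neg_lt_neg h0)
    (((tendsto_pi_nhds.1 hom i).eventually_const_lt (C.wlo_neg hi)).mono fun t => neg_lt_neg)
  have hout' : ∀ t ∈ Set.Ico 0 t₀, om t i < C.wlo i := fun t ht => neg_lt_neg_iff.1 (hout t ht)
  have hhi : om 0 i ≤ C.whi i := by linarith [C.wlo_neg hi, C.whi_pos hi]
  have hanti := strictAntiOn_of_deriv_right_neg (b := t₀) hcont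
    (fun t ht => (h.hasDerivWithinAt_om hM t ht).neg)
    fun t ht => neg_neg_of_pos (mul_pos (inv_pos.2 hM) (C.alphaTL_sub_v_pos P hi (hout' t ht)))
  exact ⟨t₀, hpos, hout', fun t ht =>
    ⟨h.wlo_le_om hi hpos.le (neg_le_neg_iff.1 hin) t ht,
      h.om_le_whi hi le_rfl hhi t (hpos.le.trans ht)⟩,
    fun s hs t ht hst => neg_lt_neg_iff.1 (hanti hs ht hst)⟩

end Controller.IsSolution

end Solution

end BilayeredControl

theorem mainTheorem1 {V : Type*} [Fintype V] [DecidableEq V] {G : SimpleGraph V}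
    [DecidableRel G.Adj]
    (P : BilayeredControl.PowerNetwork V G) (C : BilayeredControl.Controller V G)
    (hsync : P.SyncCondition)
    (hfilter : ∀ i ∈ C.Iu, C.eps i * C.tau i < 1)
    (lamInf : G.edgeSet → ℝ) (hlamInf : P.IsSyncEquilibrium lamInf)
    (lam : ℝ → G.edgeSet → ℝ) (om al u : ℝ → V → ℝ)
    (hsol : C.IsSolution P lam om al u)
    (hinit : (lam 0, om 0, al 0) ∈ C.region P lamInf) :
    -- (i) invariance of the safe frequency intervals
    (∀ i ∈ C.Iw, om 0 i ∈ Set.Icc (C.wlo i) (C.whi i) →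
      ∀ t, 0 ≤ t → om t i ∈ Set.Icc (C.wlo i) (C.whi i)) ∧
    -- (ii) attractivity in finite time, with monotone approach before the entrance time `t₀`
    (∀ i ∈ C.Iw, om 0 i ∉ Set.Icc (C.wlo i) (C.whi i) →
      ∃ t₀, 0 < t₀ ∧
        (∀ t ∈ Set.Ico 0 t₀, om t i ∉ Set.Icc (C.wlo i) (C.whi i)) ∧
        (∀ t, t₀ ≤ t → om t i ∈ Set.Icc (C.wlo i) (C.whi i)) ∧
        (C.whi i < om 0 i → StrictAntiOn (fun t => om t i) (Set.Icc 0 t₀)) ∧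
        (om 0 i < C.wlo i → StrictMonoOn (fun t => om t i) (Set.Icc 0 t₀))) ∧
    -- (iii) invariance of the level sets and convergence
    (∀ ρ : ℝ, 0 < ρ → ρ < 1 → (lam 0, om 0, al 0) ∈ C.level P lamInf ρ →
      (∀ t, 0 ≤ t → (lam t, om t, al t) ∈ C.level P lamInf ρ) ∧
      Filter.Tendsto (fun t => (lam t, om t, al t)) Filter.atTop (nhds (lamInf, 0, 0)) ∧
      Filter.Tendsto (fun t => C.alpha P (lam t) (om t) (al t)) Filter.atTop (nhds 0) ∧
      Filter.Tendsto (fun t => C.alphaTL P (lam t) (om t) (al t)) Filter.atTop (nhds 0) ∧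
      Filter.Tendsto al Filter.atTop (nhds 0) ∧
      Filter.Tendsto (fun t => C.uHat (al t) (u t)) Filter.atTop (nhds 0) ∧
      Filter.Tendsto u Filter.atTop (nhds 0)) := by
  obtain ⟨ρ₀, hρ₀, hinit⟩ := Set.mem_iUnion₂.1 hinit
  have hΥ : ∀ t, 0 ≤ t → lam t ∈ BilayeredControl.Upsilon G :=
    fun t ht => hsol.mem_Upsilon hfilter hlamInf hρ₀.2 hinit ht
  have hom := hsol.tendsto_om hfilter hlamInf hΥ
  have hal := hsol.tendsto_al hfilter hlamInf hΥ
  have hTL : Filter.Tendsto (fun t => C.alphaTL P (lam t) (om t) (al t)) Filter.atTop (nhds 0) :=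
    tendsto_pi_nhds.2 fun i => tendsto_const_nhds.congr'
      ((BilayeredControl.Controller.IsSolution.eventually_alphaTL_eq_zero C P hom i).mono
        fun _ ht => ht.symm)
  refine ⟨fun i hi h0 t ht => ?_, fun i hi h0 => ?_, fun ρ _ _ hlev => ⟨fun t ht => ?_, ?_, ?_,
    hTL, hal, hsol.tendsto_uHat hal, hsol.tendsto_u hal⟩⟩
  · exact ⟨hsol.wlo_le_om hi le_rfl h0.1 t ht, hsol.om_le_whi hi le_rfl h0.2 t ht⟩
  · have hlohi := (C.wlo_neg hi).trans (C.whi_pos hi)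
    rcases lt_or_ge (C.whi i) (om 0 i) with hhi | hhi
    · obtain ⟨t₀, hpos, hout, hin, hanti⟩ := hsol.exists_entrance_from_above hi hom hhi
      exact ⟨t₀, hpos, fun t ht hmem => absurd (hout t ht) (not_lt.2 hmem.2), hin,
        fun _ => hanti, fun hlt => absurd (hlt.trans hlohi) (not_lt.2 hhi.le)⟩
    · have hlo : om 0 i < C.wlo i := not_le.1 fun hle => h0 ⟨hle, hhi⟩
      obtain ⟨t₀, hpos, hout, hin, hmono⟩ := hsol.exists_entrance_from_below hi hom hlo
      exact ⟨t₀, hpos, fun t ht hmem => absurd (hout t ht) (not_lt.2 hmem.1), hin,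
        fun hlt => absurd hlt (not_lt.2 hhi), fun _ => hmono⟩
  · exact ⟨subset_closure (hΥ t ht),
      (hsol.energy_le hfilter hlamInf.equilibrium le_rfl ht).trans hlev.2⟩
  · exact (hsol.tendsto_lam hfilter hlamInf hΥ).prodMk_nhds (hom.prodMk_nhds hal)
  · simpa [BilayeredControl.Controller.alpha] using hTL.add hal
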